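/- Let $d\ge 0$ and $k\ge 1$ be integers, and let $f:\mathbb R^d\to[0,\infty)$ be a bounded probability density. For $n\ge 1$, $r>0$ and $\rho=(p_1,p_2,\dots)\in[0,1]^{\mathbb N}$, let $X_1,\dots,X_n$ be i.i.d. points of $\mathbb R^d$ with density $f$. The \emph{soft random Čech complex} $C(n,r,\rho)$ is the random simplicial complex with vertex set $\{X_1,\dots,X_n\}$ obtained as follows. Independently of the points and of each other, each set $\tau$ of $j+1\ge 2$ vertices has a coin which shows success with probability $p_j$; a set $\sigma$ of at least two vertices is a face if and only if $\bigcap_{X_i\in\sigma}B(X_i,r/2)\neq\emptyset$ (closed Euclidean balls) and the coins of all $\tau\subseteq\sigma$ with $|\tau|\ge 2$ show success. (Equivalently, going up in dimension, each $j$-simplex of the Čech complex whose boundary is present is kept with probability $p_j$, independently.) Let $\beta_k(C(n,r,\rho))$ be its $k$-th Betti number, i.e. the dimension of its $k$-th simplicial homology with coefficients in a fixed, arbitrary field, and let $\hat S_{k+1}(\rho)$ be the number of connected components of $C(n,r,\rho)$ which are isomorphic to an empty $(k+1)$-simplex (the boundary complex of a $(k+1)$-simplex). Theorem. Let $r=r(n)>0$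 and $\rho=\rho(n)=(p_1(n),p_2(n),\dots)\in[0,1]^{\mathbb N}$ with $p_i(n)>0$ for $1\le i\le k$, for all large $n$. Suppose that $$\lim_{n\to\infty}\frac{n r^d}{\prod_{i=1}^{k}p_i^{\binom{k+1}{i}}}=0,$$ and that either $k<d$, or $p_{k+1}(n)<1$ for all large $n$ and $\lim_{n\to\infty}\dfrac{n r^d}{(1-p_{k+1})\prod_{i=1}^{k}p_i^{\binom{k+1}{i}}}=0$. Then $$E\big(\beta_k(C(n,r,\rho))\big)\sim E\big(\hat S_{k+1}(\rho)\big),\qquad\text{that is,}\qquad \lim_{n\to\infty}\frac{E(\beta_k(C(n,r,\rho)))}{E(\hat S_{k+1}(\rho))}=1 .$$ -/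

import Mathlib

open MeasureTheory Filter Topology

namespace SoftCech

/-! ### Abstract simplicial complexes -/

section Complexes

variable {ι κ : Type*}

/-- The full subcomplex of `K` on a set `s` of vertices. -/
def induced (K : AbstractSimplicialComplex ι) (s : Set ι) : AbstractSimplicialComplex s where
  faces := {t | t.map (Function.Embedding.subtype (· ∈ s)) ∈ K}
  isRelLowerSet_faces := by
    intro t ht
    refine ⟨?_, ?_⟩
    · have h := (K.isRelLowerSet_faces ht).1
      simpa using h
    · intro u hu hne
      exact (K.isRelLowerSet_faces ht).2 (Finset.map_subset_map.2 hu) (hne.map)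
  singleton_mem v := by
    have h : ({(v : ι)} : Finset ι) ∈ K := K.singleton_mem (v : ι)
    simpa using h

/-- Isomorphism of simplicial complexes: a bijection between the vertex sets under which faces
correspond to faces. -/
def Isomorphic (K : AbstractSimplicialComplex ι) (L : AbstractSimplicialComplex κ) : Prop :=
  ∃ e : ι ≃ κ, ∀ t : Finset ι, t ∈ K ↔ t.map e.toEmbedding ∈ L

/-- The empty `(k+1)`-simplex, that is, the boundary of a `(k+1)`-simplex: the vertices are
`0, …, k+1` and the faces are all nonempty sets of vertices except the full one. -/
def emptySimplex (k : ℕ) : AbstractSimplicialComplex (Fin (k + 2)) where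
  faces := {t | t.Nonempty ∧ t ≠ Finset.univ}
  isRelLowerSet_faces := by
    rintro t ⟨hne, hu⟩
    refine ⟨hne, fun u hut hun => ⟨hun, ?_⟩⟩
    rintro rfl
    exact hu (Finset.univ_subset_iff.1 hut)
  singleton_mem v := by
    refine ⟨Finset.singleton_nonempty v, fun h => ?_⟩
    have := congrArg Finset.card h
    simp at this

/-- The `1`-skeleton of a complex, as a graph on its vertices. -/
def oneSkeleton [DecidableEq ι] (K : AbstractSimplicialComplex ι) : SimpleGraph ι where
  Adj i j := i ≠ j ∧ ({i, j} : Finset ι) ∈ K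
  symm := ⟨fun i j h => ⟨h.1.symm, by rw [Finset.pair_comm]; exact h.2⟩⟩
  loopless := ⟨fun _ h => h.1 rfl⟩

/-- The number of connected components of `K` which are isomorphic to the
empty `(k+1)`-simplex. -/
noncomputable def numEmptySimplexComponents [DecidableEq ι] (k : ℕ)
    (K : AbstractSimplicialComplex ι) : ℕ :=
  Nat.card {c : (oneSkeleton K).ConnectedComponent //
    Isomorphic (induced K c.supp) (emptySimplex k)}

end Complexes

/-! ### Simplicial homology of a complex with linearly ordered vertices -/

section Homology

variable {ι : Type*} [Fintype ι] [LinearOrder ι] (F : Type*) [Field F]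

/-- The boundary of the simplex `σ = {v₀ < v₁ < ⋯ < vₖ}`, namely
`∑ i, (-1) ^ i • {v₀, …, vₖ} \ {vᵢ}` for `k ≥ 1` and `0` for a vertex. A function `c` on finite
vertex sets stands for the formal combination `∑ σ, c σ • σ`. -/
def simplexBoundary (σ : Finset ι) : Finset ι → F :=
  if 2 ≤ σ.card then
    ∑ v ∈ σ, Pi.single (σ.erase v) ((-1 : F) ^ (σ.filter (· < v)).card)
  else 0

/-- The linear extension of `simplexBoundary` to formal combinations of finite vertex sets. -/
def boundaryMap : (Finset ι → F) →ₗ[F] (Finset ι → F) :=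
  Fintype.linearCombination F (simplexBoundary F)

/-- The space of `k`-chains of `K`: formal combinations of the `k`-dimensional faces. -/
def chains (K : AbstractSimplicialComplex ι) (k : ℕ) : Submodule F (Finset ι → F) where
  carrier := {c | ∀ σ, c σ ≠ 0 → σ ∈ K ∧ σ.card = k + 1}
  zero_mem' := fun σ h => absurd rfl h
  add_mem' := by
    intro c c' hc hc' σ h
    by_cases h0 : c σ = 0
    · exact hc' σ fun h1 => h (by simp [h0, h1])
    · exact hc σ h0
  smul_mem' := by
    intro a c hc σ h
    exact hc σ fun h0 => h (by simp [h0])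

/-- The space of `k`-cycles of `K`. -/
def cycles (K : AbstractSimplicialComplex ι) (k : ℕ) : Submodule F (Finset ι → F) :=
  chains F K k ⊓ LinearMap.ker (boundaryMap F)

/-- The space of `k`-boundaries of `K`. -/
def boundaries (K : AbstractSimplicialComplex ι) (k : ℕ) : Submodule F (Finset ι → F) :=
  (chains F K (k + 1)).map (boundaryMap F)

theorem boundaryMap_single (σ : Finset ι) (a : F) :
    boundaryMap F (Pi.single σ a) = a • simplexBoundary F σ := by
  simp [boundaryMap]

theorem boundaryMap_simplexBoundary (σ : Finset ι) :
    boundaryMap F (simplexBoundary F σ) = 0 := by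
  classical
  unfold simplexBoundary
  split_ifs with h
  swap
  · simp
  simp only [map_sum, boundaryMap_single, simplexBoundary]
  by_cases h3 : 3 ≤ σ.card
  swap
  · refine Finset.sum_eq_zero fun v hv => ?_
    rw [Finset.card_erase_of_mem hv, if_neg (by omega), smul_zero]
  have h1 : ∀ v ∈ σ, ((-1 : F) ^ (σ.filter (· < v)).card • if 2 ≤ (σ.erase v).card then
        ∑ w ∈ σ.erase v, Pi.single ((σ.erase v).erase w)
          ((-1 : F) ^ ((σ.erase v).filter (· < w)).card) else 0)
      = ∑ w ∈ σ.erase v, Pi.single ((σ.erase v).erase w)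
          ((-1 : F) ^ ((σ.filter (· < v)).card + ((σ.erase v).filter (· < w)).card)) := by
    intro v hv
    rw [Finset.card_erase_of_mem hv, if_pos (by omega), Finset.smul_sum]
    refine Finset.sum_congr rfl fun w _ => ?_
    rw [← Pi.single_smul, smul_eq_mul, pow_add]
  rw [Finset.sum_congr rfl h1, Finset.sum_sigma']
  have key : ∀ v ∈ σ, ∀ w ∈ σ, v < w →
      (σ.filter (· < w)).card = ((σ.erase v).filter (· < w)).card + 1 ∧
      ((σ.erase w).filter (· < v)).card = (σ.filter (· < v)).card := by
    intro v hv w hw hvw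
    constructor
    · rw [Finset.filter_erase, Finset.card_erase_add_one]
      exact Finset.mem_filter.2 ⟨hv, hvw⟩
    · rw [Finset.filter_erase, Finset.erase_eq_of_notMem]
      simp [hvw.le]
  refine Finset.sum_involution (fun a _ => ⟨a.2, a.1⟩) ?_ ?_ ?_ ?_
  · rintro ⟨v, w⟩ ha
    simp only [Finset.mem_sigma, Finset.mem_erase] at ha
    obtain ⟨hv, hwv, hw⟩ := ha
    dsimp only
    rw [Finset.erase_right_comm (a := w) (b := v), ← Pi.single_add]
    rw [Pi.single_eq_zero_iff]
    rcases lt_or_gt_of_ne hwv with hlt | hlt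
    · obtain ⟨e1, e2⟩ := key w hw v hv hlt
      rw [e1, e2]; ring
    · obtain ⟨e1, e2⟩ := key v hv w hw hlt
      rw [e1, e2]; ring
  · rintro ⟨v, w⟩ ha _ heq
    simp only [Finset.mem_sigma, Finset.mem_erase] at ha
    simp only [Sigma.mk.injEq] at heq
    exact ha.2.1 heq.1
  · rintro ⟨v, w⟩ ha
    simp only [Finset.mem_sigma, Finset.mem_erase] at ha ⊢
    exact ⟨ha.2.2, ha.2.1.symm, ha.1⟩
  · rintro ⟨v, w⟩ _
    rfl

theorem boundaryMap_boundaryMap (c : Finset ι → F) :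
    boundaryMap F (boundaryMap F c) = 0 := by
  have h : boundaryMap F c = ∑ σ, c σ • simplexBoundary F σ := by
    simp [boundaryMap, Fintype.linearCombination_apply]
  rw [h, map_sum]
  refine Finset.sum_eq_zero fun σ _ => ?_
  rw [map_smul, boundaryMap_simplexBoundary, smul_zero]

/-- Every boundary is a cycle. -/
theorem boundaries_le_cycles (K : AbstractSimplicialComplex ι) (k : ℕ) :
    boundaries F K k ≤ cycles F K k := by
  rintro _ ⟨c, hc, rfl⟩
  refine ⟨?_, boundaryMap_boundaryMap F c⟩
  rw [boundaryMap, Fintype.linearCombination_apply]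
  refine Submodule.sum_mem _ fun σ _ => ?_
  by_cases h0 : c σ = 0
  · rw [h0, zero_smul]; exact Submodule.zero_mem _
  refine Submodule.smul_mem _ _ ?_
  obtain ⟨hK, hcard⟩ := hc σ h0
  rw [simplexBoundary, if_pos (by omega)]
  refine Submodule.sum_mem _ fun v hv τ hτ => ?_
  have hτ' : τ = σ.erase v := by
    by_contra hne
    exact hτ (Pi.single_eq_of_ne hne _)
  have hcard' : τ.card = k + 1 := by
    rw [hτ', Finset.card_erase_of_mem hv]; omega
  refine ⟨(K.isRelLowerSet_faces hK).2 ?_ (Finset.card_pos.1 (by omega)), hcard'⟩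
  rw [hτ']
  exact Finset.erase_subset v σ

/-- The `k`-th simplicial homology `H_k(K; F)`, cycles modulo boundaries. -/
abbrev Homology (K : AbstractSimplicialComplex ι) (k : ℕ) : Type _ :=
  cycles F K k ⧸ (boundaries F K k).submoduleOf (cycles F K k)

/-- The `k`-th Betti number `β_k(K) = dim_F H_k(K; F)`. -/
noncomputable def betti (K : AbstractSimplicialComplex ι) (k : ℕ) : ℕ :=
  Module.finrank F (Homology F K k)

end Homology

/-! ### The soft random Čech complex -/

section Model

/-- The soft Čech complex on the vertices `x₀, …, x_{n-1}` (labelled by `Fin n`) at scale `r`, for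
given outcomes `b` of the coin flips of all vertex sets. A set `σ` of at least two vertices is a
face if and only if the closed balls of radius `r / 2` about its points have a common point and
the coins of `σ` and of all its subsets with at least two elements show `true`. Equivalently,
going up in dimension, a Čech simplex whose boundary is already present is kept if and only if its
own coin shows `true`. -/
def softCechComplex {n : ℕ} {E : Type*} [PseudoMetricSpace E] (r : ℝ) (x : Fin n → E)
    (b : Finset (Fin n) → Bool) : AbstractSimplicialComplex (Fin n) where
  faces := {σ | σ.Nonempty ∧ (2 ≤ σ.card →
    (⋂ i ∈ σ, Metric.closedBall (x i) (r / 2)).Nonempty ∧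
      ∀ τ ⊆ σ, 2 ≤ τ.card → b τ = true)}
  isRelLowerSet_faces := by
    rintro σ ⟨hne, hσ⟩
    refine ⟨hne, fun τ hτ hτne => ⟨hτne, fun h2 => ?_⟩⟩
    obtain ⟨⟨y, hy⟩, hb⟩ := hσ (h2.trans (Finset.card_le_card hτ))
    refine ⟨⟨y, ?_⟩, fun u hu => hb u (hu.trans hτ)⟩
    simp only [Set.mem_iInter] at hy ⊢
    exact fun i hi => hy i (hτ hi)
  singleton_mem v := by
    refine ⟨Finset.singleton_nonempty v, fun h => ?_⟩
    simp at h

/-- The joint law of the `n` points and the coins: the points are i.i.d. with density `f`, and,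
independently of them and of each other, the coin of a `j`-dimensional simplex (a set of `j + 1`
vertices) shows `true` with probability `p j`. -/
noncomputable def softCechLaw (n : ℕ) {d : ℕ} (f : EuclideanSpace ℝ (Fin d) → ℝ)
    (p : ℕ → unitInterval) :
    Measure ((Fin n → EuclideanSpace ℝ (Fin d)) × (Finset (Fin n) → Bool)) :=
  (Measure.pi fun _ : Fin n => volume.withDensity fun y => ENNReal.ofReal (f y)).prod
    (Measure.pi fun σ : Finset (Fin n) =>
      ProbabilityTheory.bernoulliMeasure true false (p (σ.card - 1)))

/-- The expected value of `β_k(C(n, r, ρ))`, with homology coefficients in `F`. -/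
noncomputable def expectedBetti (F : Type*) [Field F] (k n : ℕ) {d : ℕ}
    (f : EuclideanSpace ℝ (Fin d) → ℝ) (r : ℝ) (p : ℕ → unitInterval) : ℝ :=
  ∫ ω, (betti F (softCechComplex r ω.1 ω.2) k : ℝ) ∂(softCechLaw n f p)

/-- The expected number of connected components of `C(n, r, ρ)` which are isomorphic to the
empty `(k+1)`-simplex. -/
noncomputable def expectedEmptySimplexComponents (k n : ℕ) {d : ℕ}
    (f : EuclideanSpace ℝ (Fin d) → ℝ) (r : ℝ) (p : ℕ → unitInterval) : ℝ :=
  ∫ ω, (numEmptySimplexComponents k (softCechComplex r ω.1 ω.2) : ℝ) ∂(softCechLaw n f p)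

end Model

end SoftCech

/-! The Betti number is squeezed between two counts. Let `N` be the number of isolated empty
`(k+1)`-simplices and `M` the number of crowded `k`-faces. Every realisation satisfies `N ≤ β_k ≤ N
+ M`, over any field, and it remains to show that `E M` is negligible against `E N`.

The squeeze is local. Boundaries vanish on the facets of an isolated empty simplex, so the cycles
formed by these simplices are independent in homology (`card_emptyComponents_le_betti`). Conversely,
a cycle vanishes on an isolated `k`-face, and on an isolated set `S` of `k + 2` vertices it is
determined by one coefficient. There it bounds if `S` is a face, vanishes if a facet is missing, and
costs one dimension if `S` is an empty component. All other `k`-faces are crowded and cost at most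
one dimension each (`betti_le_card_add_card`).

A crowded face forces `k + 3` points into a ball of radius `3r` and all coins of `k + 1` vertices to
succeed. With `R = ∏ p_i ^ C(k+1, i+1)`, this gives `E M ≤ const * n^(k+3) * (r^d)^(k+2) * R`
(`integral_betti_le`). For `E N`, the density is bounded below on a set of positive measure, so `k +
2` points form a prescribed pattern at scale `r` with probability at least `const * (r^d)^(k+1)`;
the chance of an intruding further point is of smaller order because `n r^d → 0`. By Pascal's rule
the coins of the proper faces contribute `Q * R`, where `Q = ∏ p_i ^ C(k+1, i)`. Hence `E N ≥ const
* n^(k+2) * (r^d)^(k+1) * Q * R * s`, and `E M / E N` is at most a constant times `n r^d / (s * Q)`,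
which tends to `0` by hypothesis.

The factor `s` is the price of leaving the simplex empty. If `k < d`, a geometric pattern leaves it
empty whatever the top coin shows, and `s = 1`. Otherwise the points are clustered and the top coin
has to fail, and `s = 1 - p_{k+1}`. -/

namespace SoftCech

/-! ### Isolated vertex sets -/

section Isolated

variable {ι : Type*} [DecidableEq ι]

/-- No edge of `K` joins `S` to its complement. -/
def IsIsolated (K : AbstractSimplicialComplex ι) (S : Finset ι) : Prop :=
  ∀ i ∈ S, ∀ j ∉ S, ({i, j} : Finset ι) ∉ K

/-- `S` spans an empty `(k+1)`-simplex of `K` and is joined to no other vertex. -/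
structure IsEmptyComponent (K : AbstractSimplicialComplex ι) (k : ℕ) (S : Finset ι) : Prop where
  card_eq : S.card = k + 2
  notMem : S ∉ K
  mem_of_ssubset : ∀ t ⊂ S, t.Nonempty → t ∈ K
  isolated : IsIsolated K S

/-- `σ` is a `k`-face of `K` such that neither `σ` nor `σ` with one more vertex is isolated. -/
structure IsCrowdedFace (K : AbstractSimplicialComplex ι) (k : ℕ) (σ : Finset ι) : Prop where
  mem : σ ∈ K
  card_eq : σ.card = k + 1
  not_isolated : ¬ IsIsolated K σ
  not_isolated_insert : ∀ v ∉ σ, ¬ IsIsolated K (insert v σ)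

theorem mem_of_subset {ι : Type*} {K : AbstractSimplicialComplex ι} {s t : Finset ι} (hs : s ∈ K)
    (hts : t ⊆ s) (ht : t.Nonempty) : t ∈ K :=
  (K.isRelLowerSet_faces hs).2 hts ht

theorem IsIsolated.subset {K : AbstractSimplicialComplex ι} {S t : Finset ι}
    (hS : IsIsolated K S) (ht : t ∈ K) {i : ι} (hit : i ∈ t) (hiS : i ∈ S) : t ⊆ S := by
  intro j hj
  by_contra hjS
  refine hS i hiS j hjS (mem_of_subset ht ?_ (by simp))
  intro x hx
  rcases Finset.mem_insert.1 hx with rfl | hx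
  · exact hit
  · rwa [Finset.mem_singleton.1 hx]

theorem IsEmptyComponent.eq_of_mem {K : AbstractSimplicialComplex ι} {k : ℕ} {S T : Finset ι}
    (hk : 1 ≤ k)
    (hS : IsEmptyComponent K k S) (hT : IsEmptyComponent K k T) {i : ι} (hiS : i ∈ S)
    (hiT : i ∈ T) : S = T := by
  refine Finset.eq_of_subset_of_card_le (fun j hj => ?_) (by rw [hS.card_eq, hT.card_eq])
  have hss : ({i, j} : Finset ι) ⊂ S := by
    refine Finset.ssubset_iff_subset_ne.2 ⟨?_, fun h => ?_⟩
    · intro x hx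
      rcases Finset.mem_insert.1 hx with rfl | hx
      · exact hiS
      · rwa [Finset.mem_singleton.1 hx]
    · have h1 := hS.card_eq
      have h2 := Finset.card_le_two (a := i) (b := j)
      rw [h] at h2
      omega
  exact hT.isolated.subset (hS.mem_of_ssubset _ hss (by simp)) (i := i) (by simp) hiT (by simp)

end Isolated

/-! ### Deterministic bounds for the Betti number -/

section HomologyBounds

variable {ι : Type*} [LinearOrder ι] {F : Type*} [Field F]

theorem simplexBoundary_apply_erase {σ : Finset ι} (h2 : 2 ≤ σ.card) {v : ι} (hv : v ∈ σ) :
    simplexBoundary F σ (σ.erase v) = (-1 : F) ^ (σ.filter (· < v)).card := by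
  rw [simplexBoundary, if_pos h2, Finset.sum_apply, Finset.sum_eq_single v]
  · simp
  · intro w hw hwv
    refine Pi.single_eq_of_ne (fun h => hwv ?_) _
    by_contra hne
    have : w ∈ σ.erase v := Finset.mem_erase.2 ⟨hne, hw⟩
    rw [h] at this
    simp at this
  · exact fun h => absurd hv h

theorem simplexBoundary_apply_erase_ne_zero {σ : Finset ι} (h2 : 2 ≤ σ.card) {v : ι}
    (hv : v ∈ σ) : simplexBoundary F σ (σ.erase v) ≠ 0 := by
  rw [simplexBoundary_apply_erase h2 hv]
  exact pow_ne_zero _ (by simp)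

theorem exists_eq_erase_of_simplexBoundary_ne_zero {σ ρ : Finset ι}
    (h : simplexBoundary F σ ρ ≠ 0) : ∃ v ∈ σ, ρ = σ.erase v := by
  by_contra! hne
  apply h
  unfold simplexBoundary
  split_ifs with h2
  · rw [Finset.sum_apply]
    exact Finset.sum_eq_zero fun v hv => Pi.single_eq_of_ne (hne v hv) _
  · rfl

variable [Fintype ι]

theorem boundaryMap_apply (c : Finset ι → F) (ρ : Finset ι) :
    boundaryMap F c ρ = ∑ σ, c σ * simplexBoundary F σ ρ := by
  simp [boundaryMap, Fintype.linearCombination_apply, Finset.sum_apply]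

variable {K : AbstractSimplicialComplex ι} {k : ℕ}

/-- A facet of `σ` is nonempty since `k ≥ 1`, so by isolation `σ` is the only `k`-face containing
it. The coefficient of the boundary of `z` at that facet is therefore `± z σ`. -/
theorem cycles_apply_eq_zero_of_isolated (hk : 1 ≤ k) {z : Finset ι → F} (hz : z ∈ cycles F K k)
    {σ : Finset ι} (hσ : IsIsolated K σ) (hcard : σ.card = k + 1) : z σ = 0 := by
  obtain ⟨v, hv⟩ : σ.Nonempty := Finset.card_pos.1 (by omega)
  have h0 : boundaryMap F z (σ.erase v) = 0 := by
    rw [LinearMap.mem_ker.1 hz.2]; rfl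
  rw [boundaryMap_apply, Finset.sum_eq_single σ] at h0
  · exact (mul_eq_zero.1 h0).resolve_right (simplexBoundary_apply_erase_ne_zero (by omega) hv)
  · intro τ _ hτ
    by_contra hne
    obtain ⟨hzτ, hsb⟩ := mul_ne_zero_iff.1 hne
    obtain ⟨hτK, hτc⟩ := hz.1 τ hzτ
    obtain ⟨w, hw, hwe⟩ := exists_eq_erase_of_simplexBoundary_ne_zero hsb
    obtain ⟨i, hi⟩ : (σ.erase v).Nonempty :=
      Finset.card_pos.1 (by rw [Finset.card_erase_of_mem hv]; omega)
    have hsub : τ ⊆ σ := hσ.subset hτK (i := i)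
      (Finset.mem_of_mem_erase (by rwa [hwe] at hi)) (Finset.mem_of_mem_erase hi)
    exact hτ (Finset.eq_of_subset_of_card_le hsub (by omega))
  · simp

/-- By isolation, the only possible `k`-faces containing `S` without `u` and `v` are the two facets
opposite `u` and `v`. The cycle condition there links their two coefficients. -/
theorem cycles_apply_erase_eq_zero (hk : 1 ≤ k) {z : Finset ι → F} (hz : z ∈ cycles F K k)
    {S : Finset ι} (hS : IsIsolated K S) (hcard : S.card = k + 2) {u v : ι} (hu : u ∈ S)
    (hv : v ∈ S) (hzu : z (S.erase u) = 0) : z (S.erase v) = 0 := by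
  by_cases huv : u = v
  · rwa [← huv]
  have hu' : u ∈ S.erase v := Finset.mem_erase.2 ⟨huv, hu⟩
  have hcv : (S.erase v).card = k + 1 := by rw [Finset.card_erase_of_mem hv]; omega
  have h0 : boundaryMap F z ((S.erase v).erase u) = 0 := by
    rw [LinearMap.mem_ker.1 hz.2]; rfl
  rw [boundaryMap_apply, Finset.sum_eq_single (S.erase v)] at h0
  · exact (mul_eq_zero.1 h0).resolve_right (simplexBoundary_apply_erase_ne_zero (by omega) hu')
  · intro τ _ hτ
    by_contra hne
    obtain ⟨hzτ, hsb⟩ := mul_ne_zero_iff.1 hne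
    obtain ⟨hτK, hτc⟩ := hz.1 τ hzτ
    obtain ⟨w, hw, hwe⟩ := exists_eq_erase_of_simplexBoundary_ne_zero hsb
    obtain ⟨i, hi⟩ : ((S.erase v).erase u).Nonempty :=
      Finset.card_pos.1 (by rw [Finset.card_erase_of_mem hu']; omega)
    have hsub : τ ⊆ S := hS.subset hτK (i := i)
      (Finset.mem_of_mem_erase (by rwa [hwe] at hi))
      (Finset.mem_of_mem_erase (Finset.mem_of_mem_erase hi))
    obtain ⟨x, hx, hxe⟩ : ∃ x ∈ S, S.erase x = τ := by
      obtain ⟨x, hx, hxτ⟩ := Finset.exists_mem_notMem_of_card_lt_card (s := τ) (t := S) (by omega)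
      refine ⟨x, hx, (Finset.eq_of_subset_of_card_le (fun y hy => ?_) ?_).symm⟩
      · exact Finset.mem_erase.2 ⟨fun h => hxτ (h ▸ hy), hsub hy⟩
      · rw [Finset.card_erase_of_mem hx]; omega
    have hxuv : x = u ∨ x = v := by
      by_contra! h
      have hx2 : x ∈ (S.erase v).erase u := by simp [h.1, h.2, hx]
      rw [hwe, ← hxe] at hx2
      simp at hx2
    rcases hxuv with rfl | rfl
    · exact hzτ (hxe ▸ hzu)
    · exact hτ hxe.symm
  · simp

theorem simplexBoundary_mem_cycles {S : Finset ι} (hcard : S.card = k + 2)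
    (hS : ∀ t ⊂ S, t.Nonempty → t ∈ K) : simplexBoundary F S ∈ cycles F K k := by
  refine ⟨fun σ hσ => ?_, boundaryMap_simplexBoundary F S⟩
  obtain ⟨v, hv, rfl⟩ := exists_eq_erase_of_simplexBoundary_ne_zero hσ
  have hc : (S.erase v).card = k + 1 := by rw [Finset.card_erase_of_mem hv]; omega
  exact ⟨hS _ (Finset.erase_ssubset hv) (Finset.card_pos.1 (by omega)), hc⟩

theorem simplexBoundary_mem_boundaries {S : Finset ι} (hcard : S.card = k + 2) (hS : S ∈ K) :
    simplexBoundary F S ∈ boundaries F K k := by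
  refine ⟨Pi.single S 1, fun σ hσ => ?_, by simp [boundaryMap_single]⟩
  have : σ = S := by
    by_contra hne
    exact hσ (Pi.single_eq_of_ne hne _)
  exact this ▸ ⟨hS, hcard⟩

/-- A `(k+1)`-face containing a facet of `S` would lie inside `S` by isolation, hence equal `S`,
which is not a face. -/
theorem IsEmptyComponent.boundaries_apply_eq_zero (hk : 1 ≤ k) {S : Finset ι}
    (hS : IsEmptyComponent K k S) {c : Finset ι → F} (hc : c ∈ boundaries F K k) {u : ι}
    (hu : u ∈ S) : c (S.erase u) = 0 := by
  obtain ⟨w, hw, rfl⟩ := hc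
  rw [boundaryMap_apply]
  refine Finset.sum_eq_zero fun τ _ => ?_
  by_contra hne
  obtain ⟨hwτ, hsb⟩ := mul_ne_zero_iff.1 hne
  obtain ⟨hτK, hτc⟩ := hw τ hwτ
  obtain ⟨x, hx, hxe⟩ := exists_eq_erase_of_simplexBoundary_ne_zero hsb
  obtain ⟨i, hi⟩ : (S.erase u).Nonempty :=
    Finset.card_pos.1 (by rw [Finset.card_erase_of_mem hu, hS.card_eq]; omega)
  have hsub : τ ⊆ S := hS.isolated.subset hτK (i := i)
    (Finset.mem_of_mem_erase (by rwa [hxe] at hi)) (Finset.mem_of_mem_erase hi)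
  have : τ = S := Finset.eq_of_subset_of_card_le hsub (by rw [hS.card_eq, hτc])
  exact hS.notMem (this ▸ hτK)

variable (F K k)

open Classical in
/-- Isolated empty simplices contribute independent homology classes. -/
theorem card_emptyComponents_le_betti (hk : 1 ≤ k) :
    (Finset.univ.filter (IsEmptyComponent K k)).card ≤ betti F K k := by
  have hex : ∀ S : {S : Finset ι // IsEmptyComponent K k S}, ∃ u, u ∈ S.1 := fun S =>
    Finset.card_pos.1 (by rw [S.2.card_eq]; omega)
  choose u hu using hex
  have hcyc : ∀ S : {S : Finset ι // IsEmptyComponent K k S},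
      simplexBoundary F S.1 ∈ cycles F K k := fun S =>
    simplexBoundary_mem_cycles S.2.card_eq S.2.mem_of_ssubset
  have hli : LinearIndependent F (fun S : {S : Finset ι // IsEmptyComponent K k S} =>
      (Submodule.Quotient.mk ⟨simplexBoundary F S.1, hcyc S⟩ : Homology F K k)) := by
    rw [Fintype.linearIndependent_iff]
    intro g hg T
    have hb : (∑ S, g S • simplexBoundary F S.1) ∈ boundaries F K k := by
      have h1 : (Submodule.Quotient.mk (∑ S, g S • ⟨simplexBoundary F S.1, hcyc S⟩) :
          Homology F K k) = 0 := by
        rw [← hg, ← Submodule.mkQ_apply, map_sum]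
        exact Finset.sum_congr rfl fun S _ => map_smul _ _ _
      rw [Submodule.Quotient.mk_eq_zero, Submodule.submoduleOf, Submodule.mem_comap] at h1
      simpa using h1
    -- Evaluation at one facet of `T` isolates `g T`, because distinct empty components share no
    -- vertex.
    have h2 := T.2.boundaries_apply_eq_zero hk hb (hu T)
    rw [Finset.sum_apply, Finset.sum_eq_single T] at h2
    · exact (mul_eq_zero.1 h2).resolve_right
        (simplexBoundary_apply_erase_ne_zero (by rw [T.2.card_eq]; omega) (hu T))
    · intro S _ hST
      by_contra hne
      obtain ⟨-, hsb⟩ := mul_ne_zero_iff.1 hne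
      obtain ⟨x, hx, hxe⟩ := exists_eq_erase_of_simplexBoundary_ne_zero hsb
      obtain ⟨i, hi⟩ : (T.1.erase (u T)).Nonempty :=
        Finset.card_pos.1 (by rw [Finset.card_erase_of_mem (hu T), T.2.card_eq]; omega)
      have hiS : i ∈ S.1 := Finset.mem_of_mem_erase (by rwa [hxe] at hi)
      exact hST (Subtype.ext (S.2.eq_of_mem hk T.2 hiS (Finset.mem_of_mem_erase hi)))
    · simp
  have := hli.fintype_card_le_finrank
  rwa [Fintype.card_subtype] at this

open Classical in
/-- Cycles vanishing at one facet of each isolated empty simplex and on crowded faces bound. -/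
theorem mem_boundaries_of_apply_eq_zero (hk : 1 ≤ k) {z : Finset ι → F}
    (hz : z ∈ cycles F K k)
    (hE : ∀ S, IsEmptyComponent K k S → ∃ u ∈ S, z (S.erase u) = 0)
    (hC : ∀ σ, IsCrowdedFace K k σ → z σ = 0) : z ∈ boundaries F K k := by
  -- The filled isolated simplices. The cycle `z` will be the boundary of a combination of these
  -- alone, with coefficients `t`.
  let P : Finset ι → Prop := fun S => S.card = k + 2 ∧ S ∈ K ∧ IsIsolated K S
  have hex : ∀ S : Finset ι, ∃ t : F, P S → ∀ u ∈ S,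
      z (S.erase u) = t * simplexBoundary F S (S.erase u) := by
    intro S
    by_cases hS : P S
    · obtain ⟨hcard, hSK, hiso⟩ := hS
      obtain ⟨u, hu⟩ : S.Nonempty := Finset.card_pos.1 (by omega)
      have hne := simplexBoundary_apply_erase_ne_zero (F := F) (σ := S) (by omega) hu
      refine ⟨z (S.erase u) / simplexBoundary F S (S.erase u), fun _ v hv => ?_⟩
      set t := z (S.erase u) / simplexBoundary F S (S.erase u) with ht
      -- Subtracting the multiple of the boundary of `S` that matches `z` at one facet leaves a
      -- cycle vanishing there, hence at all facets of `S`.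
      have hz' : z - t • simplexBoundary F S ∈ cycles F K k :=
        Submodule.sub_mem _ hz (Submodule.smul_mem _ _
          (boundaries_le_cycles F K k (simplexBoundary_mem_boundaries hcard hSK)))
      have := cycles_apply_erase_eq_zero hk hz' hiso hcard hu hv (by
        simp [ht, hne])
      simpa [sub_eq_zero] using this
    · exact ⟨0, fun h => absurd h hS⟩
  choose t ht using hex
  have hsum : z = ∑ S ∈ Finset.univ.filter P, t S • simplexBoundary F S := by
    funext σ
    rw [Finset.sum_apply]
    by_cases hσ : ∃ S, P S ∧ ∃ v ∈ S, σ = S.erase v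
    · obtain ⟨S, hS, v, hv, rfl⟩ := hσ
      rw [Finset.sum_eq_single S, ht S hS v hv]
      · rfl
      · intro S' hS' hne
        by_contra h
        obtain ⟨-, hsb⟩ := mul_ne_zero_iff.1 h
        obtain ⟨x, hx, hxe⟩ := exists_eq_erase_of_simplexBoundary_ne_zero hsb
        obtain ⟨i, hi⟩ : (S.erase v).Nonempty :=
          Finset.card_pos.1 (by rw [Finset.card_erase_of_mem hv, hS.1]; omega)
        have hP := (Finset.mem_filter.1 hS').2
        have hsub := hS.2.2.subset hP.2.1 (i := i)
          (Finset.mem_of_mem_erase (by rwa [hxe] at hi)) (Finset.mem_of_mem_erase hi)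
        exact hne (Finset.eq_of_subset_of_card_le hsub (by rw [hS.1, hP.1]))
      · intro h
        exact absurd (Finset.mem_filter.2 ⟨Finset.mem_univ _, hS⟩) h
    · push Not at hσ
      rw [Finset.sum_eq_zero]
      swap
      · intro S hS
        by_contra h
        obtain ⟨-, hsb⟩ := mul_ne_zero_iff.1 h
        obtain ⟨x, hx, hxe⟩ := exists_eq_erase_of_simplexBoundary_ne_zero hsb
        exact hσ S (Finset.mem_filter.1 hS).2 x hx hxe
      -- Off the facets of filled simplices, a `σ` with `z σ ≠ 0` is neither isolated nor crowded,
      -- so some `insert v σ` is isolated. It is not a face, so it is an empty component or lacks a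
      -- facet; either way `z` vanishes at one facet and so at `σ`.
      by_contra hzσ
      obtain ⟨hσK, hσc⟩ := hz.1 σ hzσ
      have hni : ¬ IsIsolated K σ := fun h =>
        hzσ (cycles_apply_eq_zero_of_isolated hk hz h hσc)
      have hnc : ¬ IsCrowdedFace K k σ := fun h => hzσ (hC σ h)
      obtain ⟨v, hv, hvi⟩ : ∃ v ∉ σ, IsIsolated K (insert v σ) := by
        by_contra! h
        exact hnc ⟨hσK, hσc, hni, h⟩
      have hcard : (insert v σ).card = k + 2 := by rw [Finset.card_insert_of_notMem hv, hσc]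
      have hσe : (insert v σ).erase v = σ := Finset.erase_insert hv
      by_cases hmem : insert v σ ∈ K
      · exact hσ _ ⟨hcard, hmem, hvi⟩ v (Finset.mem_insert_self _ _) hσe.symm
      · have hu : ∃ u ∈ insert v σ, z ((insert v σ).erase u) = 0 := by
          by_cases hfac : ∀ u ∈ insert v σ, (insert v σ).erase u ∈ K
          · refine hE _ ⟨hcard, hmem, fun s hs hsne => ?_, hvi⟩
            obtain ⟨u, hu, hus⟩ := Finset.exists_of_ssubset hs
            exact mem_of_subset (hfac u hu)
              (fun y hy => Finset.mem_erase.2 ⟨fun h => hus (h ▸ hy), hs.1 hy⟩) hsne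
          · push Not at hfac
            obtain ⟨u, hu, huK⟩ := hfac
            exact ⟨u, hu, by_contra fun h => huK (hz.1 _ h).1⟩
        obtain ⟨u, hu, hzu⟩ := hu
        have := cycles_apply_erase_eq_zero hk hz hvi hcard hu (Finset.mem_insert_self v σ) hzu
        rw [hσe] at this
        exact hzσ this
  rw [hsum]
  refine Submodule.sum_mem _ fun S hS => Submodule.smul_mem _ _ ?_
  have hP := (Finset.mem_filter.1 hS).2
  exact simplexBoundary_mem_boundaries hP.1 hP.2.1

-- Evaluation at one facet per empty component and at every crowded face is a linear map on cycles
-- whose kernel consists of boundaries. Its rank thus bounds the dimension of the quotient.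
open Classical in
theorem betti_le_card_add_card (hk : 1 ≤ k) :
    betti F K k ≤ (Finset.univ.filter (IsEmptyComponent K k)).card +
      (Finset.univ.filter (IsCrowdedFace K k)).card := by
  have hex : ∀ S : {S : Finset ι // IsEmptyComponent K k S}, ∃ u, u ∈ S.1 := fun S =>
    Finset.card_pos.1 (by rw [S.2.card_eq]; omega)
  choose u hu using hex
  let L : cycles F K k →ₗ[F] ({S : Finset ι // IsEmptyComponent K k S} → F) ×
      ({σ : Finset ι // IsCrowdedFace K k σ} → F) :=
    (LinearMap.prod (LinearMap.funLeft F F fun S => S.1.erase (u S))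
      (LinearMap.funLeft F F fun σ => σ.1)).comp (cycles F K k).subtype
  have hker : LinearMap.ker L ≤ (boundaries F K k).submoduleOf (cycles F K k) := by
    rintro ⟨z, hz⟩ h
    rw [LinearMap.mem_ker] at h
    rw [Submodule.submoduleOf, Submodule.mem_comap]
    refine mem_boundaries_of_apply_eq_zero F K k hk hz (fun S hS => ?_) (fun σ hσ => ?_)
    · exact ⟨u ⟨S, hS⟩, hu ⟨S, hS⟩, congrFun (congrArg Prod.fst h) ⟨S, hS⟩⟩
    · exact congrFun (congrArg Prod.snd h) ⟨σ, hσ⟩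
  have h1 : betti F K k + Module.finrank F ((boundaries F K k).submoduleOf (cycles F K k)) =
      Module.finrank F (cycles F K k) := Submodule.finrank_quotient_add_finrank _
  have h2 := LinearMap.finrank_range_add_finrank_ker L
  have h3 := Submodule.finrank_mono hker
  have h4 := Submodule.finrank_le (LinearMap.range L)
  rw [Module.finrank_prod, Module.finrank_fintype_fun_eq_card,
    Module.finrank_fintype_fun_eq_card] at h4
  have h5 : Fintype.card {S : Finset ι // IsEmptyComponent K k S} =
      (Finset.univ.filter (IsEmptyComponent K k)).card := Fintype.card_subtype _
  have h6 : Fintype.card {σ : Finset ι // IsCrowdedFace K k σ} =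
      (Finset.univ.filter (IsCrowdedFace K k)).card := Fintype.card_subtype _
  omega

end HomologyBounds

/-! ### Components isomorphic to an empty simplex -/

section Components

variable {ι : Type*}

theorem isomorphic_induced_emptySimplex_iff (K : AbstractSimplicialComplex ι) (k : ℕ)
    (S : Finset ι) :
    Isomorphic (induced K (S : Set ι)) (emptySimplex k) ↔
      S.card = k + 2 ∧ S ∉ K ∧ ∀ t ⊂ S, t.Nonempty → t ∈ K := by
  classical
  let sub : {x // x ∈ (S : Set ι)} ↪ ι := Function.Embedding.subtype (· ∈ (S : Set ι))
  have hind : ∀ t, t ∈ induced K (S : Set ι) ↔ t.map sub ∈ K := fun t => Iff.rfl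
  have hemp : ∀ (e : {x // x ∈ (S : Set ι)} ≃ Fin (k + 2)) (t : Finset {x // x ∈ (S : Set ι)}),
      t.map e.toEmbedding ∈ emptySimplex k ↔ t.Nonempty ∧ t ≠ Finset.univ := by
    intro e t
    have h1 : t.map e.toEmbedding ∈ emptySimplex k ↔
        (t.map e.toEmbedding).Nonempty ∧ t.map e.toEmbedding ≠ Finset.univ := Iff.rfl
    rw [h1, Finset.map_nonempty, ← Finset.map_univ_equiv e, Ne, Finset.map_inj]
  have huniv : (Finset.univ : Finset {x // x ∈ (S : Set ι)}).map sub = S := by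
    ext x; simp [sub]
  have hsub : ∀ t : Finset {x // x ∈ (S : Set ι)}, t.map sub ⊆ S := by
    exact fun t => (Finset.map_subset_map.2 (Finset.subset_univ t)).trans huniv.le
  constructor
  · rintro ⟨e, he⟩
    refine ⟨by simpa using Fintype.card_congr e, fun hS => ?_, fun t ht hne => ?_⟩
    · have h1 := (he Finset.univ).1 ((hind _).2 (by rwa [huniv]))
      exact ((hemp e _).1 h1).2 rfl
    · have htm : (t.subtype (· ∈ (S : Set ι))).map sub = t := by
        ext x
        simp only [sub, Finset.subtype_map, Finset.mem_filter, Finset.mem_coe]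
        exact ⟨fun h => h.1, fun h => ⟨h, ht.1 h⟩⟩
      rw [← htm, ← hind, he, hemp]
      constructor
      · rw [← Finset.map_nonempty (f := sub), htm]; exact hne
      · intro h
        rw [h, huniv] at htm
        exact ht.ne htm.symm
  · rintro ⟨hcard, hS, hall⟩
    refine ⟨Fintype.equivFinOfCardEq (by simpa using hcard), fun t => ?_⟩
    rw [hemp, hind]
    constructor
    · intro h
      refine ⟨by simpa using (K.isRelLowerSet_faces h).1, ?_⟩
      rintro rfl
      exact hS (huniv ▸ h)
    · rintro ⟨h1, h2⟩
      refine hall _ (Finset.ssubset_iff_subset_ne.2 ⟨hsub t, fun h => h2 ?_⟩) (by simpa using h1)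
      rwa [← Finset.map_inj (f := sub), huniv]

variable [DecidableEq ι]

theorem IsIsolated.mem_of_reachable {K : AbstractSimplicialComplex ι} {S : Finset ι}
    (hS : IsIsolated K S) {i j : ι} (hi : i ∈ S) (h : (oneSkeleton K).Reachable i j) : j ∈ S := by
  obtain ⟨w⟩ := h
  by_contra hj
  obtain ⟨d, -, h1, h2⟩ := w.exists_boundary_dart (S : Set ι) hi hj
  exact hS _ h1 _ h2 d.adj.2

theorem IsEmptyComponent.supp_eq {K : AbstractSimplicialComplex ι} {k : ℕ} (hk : 1 ≤ k)
    {S : Finset ι} (hS : IsEmptyComponent K k S) {u : ι} (hu : u ∈ S) :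
    ((oneSkeleton K).connectedComponentMk u).supp = S := by
  ext j
  rw [SimpleGraph.ConnectedComponent.mem_supp_iff, SimpleGraph.ConnectedComponent.eq]
  constructor
  · exact fun h => hS.isolated.mem_of_reachable hu h.symm
  · intro hj
    by_cases hju : j = u
    · rw [hju]
    · refine SimpleGraph.Adj.reachable ⟨hju, hS.mem_of_ssubset _ ?_ (by simp)⟩
      refine Finset.ssubset_iff_subset_ne.2 ⟨Finset.insert_subset hj (by simpa using hu), ?_⟩
      intro h
      have h1 := hS.card_eq
      have h2 := Finset.card_le_two (a := j) (b := u)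
      rw [h] at h2
      omega

-- Sending `S` to the component of one of its vertices is the bijection: edges inside `S` connect it
-- since `k ≥ 1`, and isolation keeps the component inside `S`.
open Classical in
theorem numEmptySimplexComponents_eq_card [Fintype ι] (K : AbstractSimplicialComplex ι) {k : ℕ}
    (hk : 1 ≤ k) :
    numEmptySimplexComponents k K = (Finset.univ.filter (IsEmptyComponent K k)).card := by
  have hex : ∀ S : {S : Finset ι // IsEmptyComponent K k S}, ∃ u, u ∈ S.1 := fun S =>
    Finset.card_pos.1 (by rw [S.2.card_eq]; omega)
  choose u hu using hex
  have hcard : Fintype.card {S : Finset ι // IsEmptyComponent K k S} =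
      (Finset.univ.filter (IsEmptyComponent K k)).card := Fintype.card_subtype _
  rw [← hcard, ← Nat.card_eq_fintype_card, numEmptySimplexComponents]
  symm
  refine Nat.card_eq_of_bijective
    (fun S => ⟨(oneSkeleton K).connectedComponentMk (u S), ?_⟩) ⟨?_, ?_⟩
  · rw [S.2.supp_eq hk (hu S), isomorphic_induced_emptySimplex_iff]
    exact ⟨S.2.card_eq, S.2.notMem, S.2.mem_of_ssubset⟩
  · intro S T hST
    have h := congrArg (fun c => c.1.supp) hST
    simp only [S.2.supp_eq hk (hu S), T.2.supp_eq hk (hu T)] at h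
    exact Subtype.ext (Finset.coe_injective h)
  · rintro ⟨c, hc⟩
    obtain ⟨S, hS⟩ : ∃ S : Finset ι, (S : Set ι) = c.supp := ⟨c.supp.toFinset, by simp⟩
    rw [← hS, isomorphic_induced_emptySimplex_iff] at hc
    have hE : IsEmptyComponent K k S := by
      refine ⟨hc.1, hc.2.1, hc.2.2, fun i hi j hj hij => hj ?_⟩
      have hi' : i ∈ c.supp := hS ▸ hi
      have hadj : (oneSkeleton K).Adj i j := ⟨fun h => hj (h ▸ hi), hij⟩
      rw [← Finset.mem_coe, hS]
      exact (SimpleGraph.ConnectedComponent.mem_supp_congr_adj c hadj).1 hi'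
    refine ⟨⟨S, hE⟩, Subtype.ext ?_⟩
    have : u ⟨S, hE⟩ ∈ c.supp := hS ▸ hu ⟨S, hE⟩
    exact this

end Components

/-! ### Geometry of faces in the soft Čech complex -/

section Faces

variable {n : ℕ} {E : Type*} [PseudoMetricSpace E] {r : ℝ} {x : Fin n → E}
  {b : Finset (Fin n) → Bool}

theorem dist_le_of_iInter_closedBall_nonempty {σ : Finset (Fin n)}
    (h : (⋂ i ∈ σ, Metric.closedBall (x i) (r / 2)).Nonempty) {i j : Fin n} (hi : i ∈ σ)
    (hj : j ∈ σ) : dist (x i) (x j) ≤ r := by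
  obtain ⟨y, hy⟩ := h
  simp only [Set.mem_iInter, Metric.mem_closedBall] at hy
  have h1 := dist_triangle_left (x i) (x j) y
  linarith [hy i hi, hy j hj]

theorem dist_le_of_mem_softCechComplex (hr : 0 ≤ r) {σ : Finset (Fin n)}
    (h : σ ∈ softCechComplex r x b) {i j : Fin n} (hi : i ∈ σ) (hj : j ∈ σ) :
    dist (x i) (x j) ≤ r := by
  by_cases hij : i = j
  · simpa [hij] using hr
  · exact dist_le_of_iInter_closedBall_nonempty
      (h.2 (Finset.one_lt_card.2 ⟨i, hi, j, hj, hij⟩)).1 hi hj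

theorem exists_dist_le_of_not_isIsolated (hr : 0 ≤ r) {S : Finset (Fin n)}
    (h : ¬ IsIsolated (softCechComplex r x b) S) : ∃ i ∈ S, ∃ j ∉ S, dist (x j) (x i) ≤ r := by
  unfold IsIsolated at h
  push Not at h
  obtain ⟨i, hi, j, hj, hij⟩ := h
  exact ⟨i, hi, j, hj, dist_le_of_mem_softCechComplex hr hij (by simp) (by simp)⟩

/-- The face has diameter at most `r`, and each of the two failures of isolation adds one vertex and
at most one further step of length `r`. -/
theorem IsCrowdedFace.exists_dist_le (hr : 0 ≤ r) {k : ℕ} {σ : Finset (Fin n)}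
    (h : IsCrowdedFace (softCechComplex r x b) k σ) {o : Fin n} (ho : o ∈ σ) :
    ∃ v ∉ σ, ∃ w ∉ insert v σ, ∀ i ∈ insert w (insert v σ), dist (x i) (x o) ≤ 3 * r := by
  obtain ⟨i, hi, v, hv, hvi⟩ := exists_dist_le_of_not_isIsolated hr h.not_isolated
  obtain ⟨j, hj, w, hw, hwj⟩ := exists_dist_le_of_not_isIsolated hr (h.not_isolated_insert v hv)
  have h1 : ∀ l ∈ σ, dist (x l) (x o) ≤ r := fun l hl =>
    dist_le_of_mem_softCechComplex hr h.mem hl ho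
  have h2 : ∀ l ∈ insert v σ, dist (x l) (x o) ≤ 2 * r := by
    intro l hl
    rcases Finset.mem_insert.1 hl with rfl | hl
    · linarith [dist_triangle (x l) (x i) (x o), h1 i hi]
    · linarith [h1 l hl]
  refine ⟨v, hv, w, hw, fun l hl => ?_⟩
  rcases Finset.mem_insert.1 hl with rfl | hl
  · linarith [dist_triangle (x l) (x j) (x o), h2 j hj]
  · linarith [h2 l hl]

theorem IsCrowdedFace.coin_eq_true {k : ℕ} (hk : 1 ≤ k) {σ : Finset (Fin n)}
    (h : IsCrowdedFace (softCechComplex r x b) k σ) :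
    ∀ τ ⊆ σ, 2 ≤ τ.card → b τ = true :=
  (h.mem.2 (by rw [h.card_eq]; omega)).2

theorem isEmptyComponent_softCechComplex (hr : 0 ≤ r) {k : ℕ} {S : Finset (Fin n)}
    (hcard : S.card = k + 2)
    (hball : ∀ t ⊂ S, (⋂ i ∈ t, Metric.closedBall (x i) (r / 2)).Nonempty)
    (hcoin : ∀ τ ⊂ S, 2 ≤ τ.card → b τ = true)
    (hempty : ¬ (⋂ i ∈ S, Metric.closedBall (x i) (r / 2)).Nonempty ∨ b S = false)
    (hfar : ∀ i ∈ S, ∀ j ∉ S, r < dist (x j) (x i)) :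
    IsEmptyComponent (softCechComplex r x b) k S where
  card_eq := hcard
  notMem h := by
    have h2 := h.2 (by omega)
    rcases hempty with h3 | h3
    · exact h3 h2.1
    · simp [h2.2 S subset_rfl (by omega)] at h3
  mem_of_ssubset t ht hne :=
    ⟨hne, fun _ => ⟨hball t ht, fun τ hτ hτ2 => hcoin τ (hτ.trans_ssubset ht) hτ2⟩⟩
  isolated i hi j hj h :=
    absurd (dist_le_of_mem_softCechComplex hr h (i := j) (j := i) (by simp) (by simp))
      (not_le.2 (hfar i hi j hj))

end Faces

/-! ### Measurability and integrability of functions of the complex -/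

section Measurability

variable {E : Type*} [MetricSpace E] [ProperSpace E]

/-- Compactness: for a convergent sequence of configurations the common points stay bounded, and a
subsequential limit is a common point of the limiting balls. -/
theorem isClosed_setOf_iInter_closedBall_nonempty {ι : Type*} (σ : Finset ι) (ρ : ℝ) :
    IsClosed {x : ι → E | (⋂ i ∈ σ, Metric.closedBall (x i) ρ).Nonempty} := by
  classical
  rcases σ.eq_empty_or_nonempty with rfl | ⟨o, ho⟩
  · simp only [Finset.notMem_empty, Set.iInter_of_empty, Set.iInter_univ]
    exact isClosed_const
  have hS : {x : ι → E | (⋂ i ∈ σ, Metric.closedBall (x i) ρ).Nonempty} =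
      (fun x (i : σ) => x i) ⁻¹'
        {x : σ → E | (⋂ i, Metric.closedBall (x i) ρ).Nonempty} := by
    ext x
    simp only [Set.mem_ofPred_eq, Set.mem_preimage]
    rw [Set.iInter_subtype]
  rw [hS]
  refine IsClosed.preimage (by fun_prop) ?_
  refine IsSeqClosed.isClosed fun u x hu hux => ?_
  choose y hy using hu
  simp only [Set.mem_iInter, Metric.mem_closedBall] at hy
  have hux' : ∀ i, Tendsto (fun m => u m i) atTop (𝓝 (x i)) := fun i => tendsto_pi_nhds.1 hux i
  obtain ⟨C, hC⟩ := (Metric.isBounded_range_of_tendsto _ (hux' ⟨o, ho⟩)).subset_closedBall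
    (x ⟨o, ho⟩)
  have hb : ∀ m, y m ∈ Metric.closedBall (x ⟨o, ho⟩) (ρ + C) := by
    intro m
    have h1 := hC (Set.mem_range_self m)
    rw [Metric.mem_closedBall] at h1 ⊢
    linarith [dist_triangle (y m) (u m ⟨o, ho⟩) (x ⟨o, ho⟩), hy m ⟨o, ho⟩]
  obtain ⟨z, -, φ, hφ, hz⟩ := tendsto_subseq_of_bounded Metric.isBounded_closedBall hb
  refine ⟨z, Set.mem_iInter.2 fun i => Metric.mem_closedBall.2 ?_⟩
  exact le_of_tendsto (hz.dist ((hux' i).comp hφ.tendsto_atTop))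
    (Eventually.of_forall fun m => hy (φ m) i)

variable [MeasurableSpace E] [BorelSpace E] [SecondCountableTopology E]

/-- A complex on `Fin n` is encoded by the truth values of its faces. This code lives in a finite
space, on which every function is measurable, so only the event that a given `σ` is a face has to be
checked. -/
theorem measurable_comp_softCechComplex {n : ℕ} (r : ℝ)
    (φ : AbstractSimplicialComplex (Fin n) → ℝ) :
    Measurable fun ω : (Fin n → E) × (Finset (Fin n) → Bool) =>
      φ (softCechComplex r ω.1 ω.2) := by
  let G : AbstractSimplicialComplex (Fin n) → (Finset (Fin n) → Prop) := fun K σ => σ ∈ K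
  have hG : Function.Injective G := fun K L h => SetLike.ext fun σ => iff_of_eq (congrFun h σ)
  have hfac : (fun ω : (Fin n → E) × (Finset (Fin n) → Bool) =>
      φ (softCechComplex r ω.1 ω.2)) =
      Function.extend G φ 0 ∘ fun ω => G (softCechComplex r ω.1 ω.2) := by
    funext ω
    exact (hG.extend_apply φ 0 _).symm
  rw [hfac]
  refine (measurable_of_finite _).comp (measurable_pi_iff.2 fun σ => ?_)
  refine measurableSet_setOfPred.1 ?_
  have hset : {ω : (Fin n → E) × (Finset (Fin n) → Bool) | G (softCechComplex r ω.1 ω.2) σ} =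
      {ω | σ.Nonempty ∧ (2 ≤ σ.card →
        (ω.1 ∈ {x : Fin n → E | (⋂ i ∈ σ, Metric.closedBall (x i) (r / 2)).Nonempty}) ∧
          ω.2 ∈ {b : Finset (Fin n) → Bool | ∀ τ ⊆ σ, 2 ≤ τ.card → b τ = true})} := rfl
  rw [hset]
  have h1 : MeasurableSet {x : Fin n → E |
      (⋂ i ∈ σ, Metric.closedBall (x i) (r / 2)).Nonempty} :=
    (isClosed_setOf_iInter_closedBall_nonempty σ (r / 2)).measurableSet
  have h2 : MeasurableSet {b : Finset (Fin n) → Bool | ∀ τ ⊆ σ, 2 ≤ τ.card → b τ = true} :=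
    Set.toFinite _ |>.measurableSet
  have h3 := (measurable_fst h1).inter (measurable_snd h2 :
    MeasurableSet ((Prod.snd : (Fin n → E) × (Finset (Fin n) → Bool) → _) ⁻¹' _))
  by_cases hne : σ.Nonempty <;> by_cases h2c : 2 ≤ σ.card <;> simp only [hne, h2c, true_and,
    false_and, true_implies, false_implies, Set.ofPred_true, Set.ofPred_false, MeasurableSet.univ,
    MeasurableSet.empty]
  exact h3

theorem integrable_comp_softCechComplex {n : ℕ} (r : ℝ)
    (φ : AbstractSimplicialComplex (Fin n) → ℝ)
    (P : Measure ((Fin n → E) × (Finset (Fin n) → Bool))) [IsFiniteMeasure P] :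
    Integrable (fun ω => φ (softCechComplex r ω.1 ω.2)) P := by
  have hfin : Finite (AbstractSimplicialComplex (Fin n)) :=
    Finite.of_injective (fun K => {σ | σ ∈ K}) fun K L h => SetLike.ext fun σ => Set.ext_iff.1 h σ
  obtain ⟨C, hC⟩ := (Set.finite_range fun K => ‖φ K‖).bddAbove
  exact Integrable.of_bound (measurable_comp_softCechComplex r φ).aestronglyMeasurable C
    (Eventually.of_forall fun ω => hC ⟨_, rfl⟩)

theorem measurableSet_setOf_softCechComplex {n : ℕ} (r : ℝ)
    (Q : AbstractSimplicialComplex (Fin n) → Prop) :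
    MeasurableSet {ω : (Fin n → E) × (Finset (Fin n) → Bool) |
      Q (softCechComplex r ω.1 ω.2)} := by
  classical
  have h := measurable_comp_softCechComplex (E := E) r (fun K => if Q K then (1 : ℝ) else 0)
    (measurableSet_singleton 1)
  convert h using 1
  ext ω
  simp

end Measurability

/-! ### Marginals and clustering of independent points -/

section PointMeasure

variable {E : Type*} [MeasurableSpace E]

/-- Forgetting points of an i.i.d. sample leaves an i.i.d. sample. -/
theorem measurePreserving_pi_comp_embedding {ι κ : Type*} [Fintype ι] [Fintype κ]
    (μ : Measure E) [IsProbabilityMeasure μ] (e : κ ↪ ι) :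
    MeasurePreserving (fun (x : ι → E) j => x (e j)) (Measure.pi fun _ => μ)
      (Measure.pi fun _ => μ) := by
  classical
  have hm : Measurable (fun (x : ι → E) (j : κ) => x (e j)) :=
    measurable_pi_iff.2 fun j => measurable_pi_apply _
  refine ⟨hm, (Measure.pi_eq fun s hs => ?_).symm⟩
  rw [Measure.map_apply hm (MeasurableSet.univ_pi hs)]
  have hset : (fun (x : ι → E) (j : κ) => x (e j)) ⁻¹' Set.univ.pi s =
      Set.pi (Finset.univ.map e : Finset ι) (Function.extend e s fun _ => Set.univ) := by
    ext x
    simp [Set.mem_pi, e.injective.extend_apply]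
  rw [hset, Measure.pi_pi_finset, Finset.prod_map]
  simp [e.injective.extend_apply]

variable [PseudoMetricSpace E] [OpensMeasurableSpace E] [SecondCountableTopology E]

/-- The probability that all points in `T` are within distance `ρ` of one of them. -/
theorem pi_setOf_forall_dist_le_le {n : ℕ} (μ : Measure E) [IsProbabilityMeasure μ] {ρ : ℝ}
    {q : ENNReal} (hq : ∀ a, μ (Metric.closedBall a ρ) ≤ q) {T : Finset (Fin n)} {o : Fin n}
    (ho : o ∈ T) :
    Measure.pi (fun _ : Fin n => μ) {x | ∀ i ∈ T, dist (x i) (x o) ≤ ρ} ≤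
      q ^ (T.card - 1) := by
  classical
  obtain _ | n := n
  · exact o.elim0
  have hmp := measurePreserving_piFinSuccAbove (fun _ : Fin (n + 1) => μ) o
  let T' : Finset (Fin n) := Finset.univ.filter fun j => o.succAbove j ∈ T
  let B : Set (E × (Fin n → E)) := {p | ∀ j ∈ T', dist (p.2 j) p.1 ≤ ρ}
  have hB : MeasurableSet B := by
    refine MeasurableSet.congr (s := ⋂ j ∈ T', {p : E × (Fin n → E) | dist (p.2 j) p.1 ≤ ρ}) ?_
      (by ext; simp [B])
    exact MeasurableSet.biInter T'.countable_toSet fun j _ =>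
      measurableSet_le (((measurable_pi_apply j).comp measurable_snd).dist measurable_fst)
        measurable_const
  have hsub : {x : Fin (n + 1) → E | ∀ i ∈ T, dist (x i) (x o) ≤ ρ} ⊆
      MeasurableEquiv.piFinSuccAbove (fun _ => E) o ⁻¹' B := by
    intro x hx j hj
    exact hx _ (Finset.mem_filter.1 hj).2
  have hcard : T'.card = T.card - 1 := by
    rw [← Finset.card_erase_of_mem ho, ← Finset.card_map o.succAboveEmb]
    congr 1
    ext i
    simp only [T', Finset.mem_map, Finset.mem_filter, Finset.mem_univ, true_and,
      Fin.coe_succAboveEmb, Finset.mem_erase]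
    constructor
    · rintro ⟨j, hj, rfl⟩
      exact ⟨Fin.succAbove_ne o j, hj⟩
    · rintro ⟨hio, hi⟩
      obtain ⟨j, rfl⟩ := Fin.exists_succAbove_eq hio
      exact ⟨j, hi, rfl⟩
  calc Measure.pi (fun _ : Fin (n + 1) => μ) {x | ∀ i ∈ T, dist (x i) (x o) ≤ ρ}
      ≤ Measure.pi (fun _ : Fin (n + 1) => μ)
          (MeasurableEquiv.piFinSuccAbove (fun _ => E) o ⁻¹' B) := measure_mono hsub
    _ = (μ.prod (Measure.pi fun _ : Fin n => μ)) B := hmp.measure_preimage hB.nullMeasurableSet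
    -- Conditionally on the point `x o`, the other points of `T` fall independently into one fixed
    -- ball.
    _ = ∫⁻ a, Measure.pi (fun _ : Fin n => μ) (Prod.mk a ⁻¹' B) ∂μ := Measure.prod_apply hB
    _ ≤ ∫⁻ _, q ^ (T.card - 1) ∂μ := by
        refine lintegral_mono fun a => ?_
        have hsec : Prod.mk a ⁻¹' B = Set.pi (T' : Set (Fin n))
            (fun _ => Metric.closedBall a ρ) := by
          ext y
          simp [B, Set.mem_pi]
        rw [hsec, Measure.pi_pi_finset, ← hcard]
        exact Finset.prod_le_pow_card _ _ _ fun i _ => hq a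
    _ = q ^ (T.card - 1) := by simp

end PointMeasure

/-! ### Coin probabilities -/

section Coins

/-- The probability that the coins of all `j`-dimensional subsets of `σ` lie in `A j`, for
all `j ≥ 1`. -/
theorem pi_bernoulliMeasure_real_setOf_subsets {n : ℕ} (p : ℕ → unitInterval)
    (A : ℕ → Set Bool) (σ : Finset (Fin n)) :
    (Measure.pi fun τ : Finset (Fin n) =>
      ProbabilityTheory.bernoulliMeasure true false (p (τ.card - 1))).real
        {b | ∀ τ ⊆ σ, 2 ≤ τ.card → b τ ∈ A (τ.card - 1)} =
      ∏ i ∈ Finset.Icc 1 (σ.card - 1),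
        (ProbabilityTheory.bernoulliMeasure true false (p i)).real (A i) ^
          σ.card.choose (i + 1) := by
  classical
  let g : ℕ → ℝ := fun i => (ProbabilityTheory.bernoulliMeasure true false (p i)).real (A i)
  have hset : {b : Finset (Fin n) → Bool | ∀ τ ⊆ σ, 2 ≤ τ.card → b τ ∈ A (τ.card - 1)} =
      Set.pi (σ.powerset.filter fun τ => 2 ≤ τ.card : Finset (Finset (Fin n)))
        (fun τ => A (τ.card - 1)) := by
    ext b
    simp only [Set.mem_ofPred_eq, Set.mem_pi, Finset.mem_coe, Finset.mem_filter,
      Finset.mem_powerset, and_imp]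
  rw [hset, Measure.real, Measure.pi_pi_finset, ENNReal.toReal_prod, Finset.prod_filter,
    Finset.prod_powerset]
  have h1 : ∀ j ∈ Finset.range (σ.card + 1), (∏ τ ∈ σ.powersetCard j, if 2 ≤ τ.card then
      ((ProbabilityTheory.bernoulliMeasure true false (p (τ.card - 1))) (A (τ.card - 1))).toReal
      else 1) = if 2 ≤ j then g (j - 1) ^ σ.card.choose j else 1 := by
    intro j _
    rw [Finset.prod_congr rfl (g := fun _ => if 2 ≤ j then g (j - 1) else 1)]
    · rw [Finset.prod_const, Finset.card_powersetCard]
      split_ifs <;> simp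
    · intro τ hτ
      rw [(Finset.mem_powersetCard.1 hτ).2]
      rfl
  rw [Finset.prod_congr rfl h1, ← Finset.prod_filter]
  symm
  refine Finset.prod_bij (fun i _ => i + 1) ?_ ?_ ?_ ?_
  · intro i hi
    rw [Finset.mem_Icc] at hi
    simp only [Finset.mem_filter, Finset.mem_range]
    omega
  · intro i _ j _ h
    omega
  · intro j hj
    simp only [Finset.mem_filter, Finset.mem_range] at hj
    exact ⟨j - 1, Finset.mem_Icc.2 (by omega), by omega⟩
  · intro i _
    rfl

theorem bernoulliMeasure_real_singleton_true (p : unitInterval) :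
    (ProbabilityTheory.bernoulliMeasure true false p).real {true} = p := by
  classical
  rw [ProbabilityTheory.bernoulliMeasure_real_apply p (measurableSet_singleton _)]
  simp

theorem bernoulliMeasure_real_singleton_false (p : unitInterval) :
    (ProbabilityTheory.bernoulliMeasure true false p).real {false} = 1 - p := by
  classical
  rw [ProbabilityTheory.bernoulliMeasure_real_apply p (measurableSet_singleton _)]
  simp

end Coins

/-! ### Bounds for the expected counts -/

section Expectations

variable {n : ℕ} {E : Type*} [MetricSpace E] [ProperSpace E] [MeasurableSpace E] [BorelSpace E]
  [SecondCountableTopology E]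

open Classical in
theorem integral_card_filter_softCechComplex (r : ℝ)
    (P : Measure ((Fin n → E) × (Finset (Fin n) → Bool))) [IsFiniteMeasure P]
    (Q : AbstractSimplicialComplex (Fin n) → Finset (Fin n) → Prop) :
    ∫ ω, ((Finset.univ.filter (Q (softCechComplex r ω.1 ω.2))).card : ℝ) ∂P =
      ∑ S, P.real {ω | Q (softCechComplex r ω.1 ω.2) S} := by
  have h1 : ∀ ω : (Fin n → E) × (Finset (Fin n) → Bool),
      ((Finset.univ.filter (Q (softCechComplex r ω.1 ω.2))).card : ℝ) =
        ∑ S, if Q (softCechComplex r ω.1 ω.2) S then (1 : ℝ) else 0 := by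
    intro ω
    rw [Finset.card_filter]
    push_cast
    rfl
  simp_rw [h1]
  rw [integral_finsetSum _ fun S _ =>
    integrable_comp_softCechComplex r (fun K => if Q K S then (1 : ℝ) else 0) P]
  refine Finset.sum_congr rfl fun S _ => ?_
  rw [← integral_indicator_one (measurableSet_setOf_softCechComplex r fun K => Q K S)]
  rfl

variable (μ : Measure E) [IsProbabilityMeasure μ] (p : ℕ → unitInterval)

/-- The joint law of `n` independent points with law `μ` and the coins. -/
noncomputable abbrev sampleLaw (n : ℕ) : Measure ((Fin n → E) × (Finset (Fin n) → Bool)) :=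
  (Measure.pi fun _ : Fin n => μ).prod (Measure.pi fun σ : Finset (Fin n) =>
    ProbabilityTheory.bernoulliMeasure true false (p (σ.card - 1)))

variable {μ p} {k : ℕ} {r q : ℝ}

omit [ProperSpace E] [BorelSpace E] [SecondCountableTopology E] in
theorem nonneg_of_measureReal_closedBall_le {ρ : ℝ}
    (hq : ∀ a, μ.real (Metric.closedBall a ρ) ≤ q) : 0 ≤ q :=
  measureReal_nonneg.trans (hq (nonempty_of_isProbabilityMeasure μ).some)

omit [ProperSpace E] in
theorem pi_real_setOf_forall_dist_le_le {ρ : ℝ} (hq : ∀ a, μ.real (Metric.closedBall a ρ) ≤ q)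
    {T : Finset (Fin n)} {o : Fin n} (ho : o ∈ T) :
    (Measure.pi fun _ : Fin n => μ).real {x | ∀ i ∈ T, dist (x i) (x o) ≤ ρ} ≤
      q ^ (T.card - 1) := by
  have hq0 := nonneg_of_measureReal_closedBall_le hq
  refine ENNReal.toReal_le_of_le_ofReal (pow_nonneg hq0 _) ?_
  rw [ENNReal.ofReal_pow hq0]
  exact pi_setOf_forall_dist_le_le μ
    (fun a => (ENNReal.le_ofReal_iff_toReal_le (measure_ne_top _ _) hq0).2 (hq a)) ho

omit [ProperSpace E] in
theorem sampleLaw_real_isCrowdedFace_le (hk : 1 ≤ k) (hr : 0 ≤ r)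
    (hq : ∀ a, μ.real (Metric.closedBall a (3 * r)) ≤ q) {σ : Finset (Fin n)}
    (hσ : σ.card = k + 1) :
    (sampleLaw μ p n).real {ω | IsCrowdedFace (softCechComplex r ω.1 ω.2) k σ} ≤
      n ^ 2 * (q ^ (k + 2) * ∏ i ∈ Finset.Icc 1 k, (p i : ℝ) ^ (k + 1).choose (i + 1)) := by
  classical
  obtain ⟨o, ho⟩ : σ.Nonempty := Finset.card_pos.1 (by omega)
  let I : Finset (Fin n × Fin n) := Finset.univ.filter fun v => v.1 ∉ σ ∧ v.2 ∉ insert v.1 σ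
  let N : Fin n × Fin n → Set (Fin n → E) := fun v =>
    {x | ∀ i ∈ insert v.2 (insert v.1 σ), dist (x i) (x o) ≤ 3 * r}
  let C : Set (Finset (Fin n) → Bool) := {b | ∀ τ ⊆ σ, 2 ≤ τ.card → b τ ∈ ({true} : Set Bool)}
  have hsub : {ω : (Fin n → E) × (Finset (Fin n) → Bool) |
      IsCrowdedFace (softCechComplex r ω.1 ω.2) k σ} ⊆ ⋃ v ∈ I, N v ×ˢ C := by
    intro ω hω
    obtain ⟨v, hv, w, hw, h⟩ := IsCrowdedFace.exists_dist_le hr hω ho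
    simp only [Set.mem_iUnion]
    exact ⟨(v, w), Finset.mem_filter.2 ⟨Finset.mem_univ _, hv, hw⟩, h, hω.coin_eq_true hk⟩
  have hC := pi_bernoulliMeasure_real_setOf_subsets p (fun _ => {true}) σ
  simp only [bernoulliMeasure_real_singleton_true, hσ] at hC
  have hterm : ∀ v ∈ I, (sampleLaw μ p n).real (N v ×ˢ C) ≤
      q ^ (k + 2) * ∏ i ∈ Finset.Icc 1 k, (p i : ℝ) ^ (k + 1).choose (i + 1) := by
    intro v hv
    obtain ⟨-, hv1, hv2⟩ := Finset.mem_filter.1 hv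
    rw [measureReal_prod_prod]
    refine mul_le_mul ?_ hC.le measureReal_nonneg ?_
    · have h := pi_real_setOf_forall_dist_le_le hq (T := insert v.2 (insert v.1 σ)) (o := o)
        (by simp [ho])
      rwa [Finset.card_insert_of_notMem hv2, Finset.card_insert_of_notMem hv1, hσ] at h
    · exact pow_nonneg (nonneg_of_measureReal_closedBall_le hq) _
  have hpos : 0 ≤ q ^ (k + 2) * ∏ i ∈ Finset.Icc 1 k, (p i : ℝ) ^ (k + 1).choose (i + 1) := by
    refine mul_nonneg (pow_nonneg (nonneg_of_measureReal_closedBall_le hq) _) ?_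
    exact Finset.prod_nonneg fun i _ => pow_nonneg (p i).2.1 _
  calc (sampleLaw μ p n).real {ω | IsCrowdedFace (softCechComplex r ω.1 ω.2) k σ}
      ≤ (sampleLaw μ p n).real (⋃ v ∈ I, N v ×ˢ C) :=
        measureReal_mono hsub (measure_ne_top _ _)
    _ ≤ ∑ v ∈ I, (sampleLaw μ p n).real (N v ×ˢ C) := measureReal_biUnion_finset_le _ _
    _ ≤ I.card • (q ^ (k + 2) * ∏ i ∈ Finset.Icc 1 k, (p i : ℝ) ^ (k + 1).choose (i + 1)) :=
        Finset.sum_le_card_nsmul _ _ _ hterm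
    _ ≤ _ := by
        rw [nsmul_eq_mul]
        refine mul_le_mul_of_nonneg_right ?_ hpos
        have : I.card ≤ n ^ 2 := (Finset.card_le_univ _).trans (by simp [sq])
        exact_mod_cast this

theorem integral_numEmptySimplexComponents_le_integral_betti (F : Type*) [Field F] (hk : 1 ≤ k) :
    ∫ ω, (numEmptySimplexComponents k (softCechComplex r ω.1 ω.2) : ℝ) ∂(sampleLaw μ p n) ≤
      ∫ ω, (betti F (softCechComplex r ω.1 ω.2) k : ℝ) ∂(sampleLaw μ p n) := by
  classical
  refine integral_mono
    (integrable_comp_softCechComplex r (fun K => (numEmptySimplexComponents k K : ℝ)) _)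
    (integrable_comp_softCechComplex r (fun K => (betti F K k : ℝ)) _) fun ω => ?_
  simp only [numEmptySimplexComponents_eq_card _ hk, Nat.cast_le]
  exact card_emptyComponents_le_betti F _ k hk

theorem integral_betti_le (F : Type*) [Field F] (hk : 1 ≤ k) (hr : 0 ≤ r)
    (hq : ∀ a, μ.real (Metric.closedBall a (3 * r)) ≤ q) :
    ∫ ω, (betti F (softCechComplex r ω.1 ω.2) k : ℝ) ∂(sampleLaw μ p n) ≤
      ∫ ω, (numEmptySimplexComponents k (softCechComplex r ω.1 ω.2) : ℝ) ∂(sampleLaw μ p n) +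
      n ^ (k + 3) * (q ^ (k + 2) * ∏ i ∈ Finset.Icc 1 k, (p i : ℝ) ^ (k + 1).choose (i + 1)) := by
  classical
  set B := q ^ (k + 2) * ∏ i ∈ Finset.Icc 1 k, (p i : ℝ) ^ (k + 1).choose (i + 1) with hBdef
  have hpos : 0 ≤ B := by
    refine mul_nonneg (pow_nonneg (nonneg_of_measureReal_closedBall_le hq) _) ?_
    exact Finset.prod_nonneg fun i _ => pow_nonneg (p i).2.1 _
  have hcrowd : ∫ ω, ((Finset.univ.filter
      (IsCrowdedFace (softCechComplex r ω.1 ω.2) k)).card : ℝ) ∂(sampleLaw μ p n) ≤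
      n ^ (k + 3) * B := by
    rw [integral_card_filter_softCechComplex r _ fun K S => IsCrowdedFace K k S]
    rw [← Finset.sum_subset (Finset.subset_univ (Finset.powersetCard (k + 1) Finset.univ))]
    · calc _ ≤ (Finset.powersetCard (k + 1) (Finset.univ : Finset (Fin n))).card •
            ((n : ℝ) ^ 2 * B) := Finset.sum_le_card_nsmul _ _ _ fun σ hσ =>
              sampleLaw_real_isCrowdedFace_le hk hr hq (Finset.mem_powersetCard.1 hσ).2
        _ ≤ (n : ℝ) ^ (k + 1) * (n ^ 2 * B) := by
            rw [nsmul_eq_mul, Finset.card_powersetCard, Finset.card_univ, Fintype.card_fin]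
            refine mul_le_mul_of_nonneg_right ?_ (by positivity)
            exact_mod_cast Nat.choose_le_pow n (k + 1)
        _ = n ^ (k + 3) * B := by ring
    · intro σ _ hσ
      have : {ω : (Fin n → E) × (Finset (Fin n) → Bool) |
          IsCrowdedFace (softCechComplex r ω.1 ω.2) k σ} = ∅ := by
        refine Set.eq_empty_of_forall_notMem fun ω hω => hσ ?_
        exact Finset.mem_powersetCard.2 ⟨Finset.subset_univ _, IsCrowdedFace.card_eq hω⟩
      rw [this, measureReal_empty]
  refine le_trans ?_ (add_le_add_right hcrowd _)
  rw [← integral_add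
    (integrable_comp_softCechComplex r (fun K => (numEmptySimplexComponents k K : ℝ)) _)
    (integrable_comp_softCechComplex r (fun K =>
      ((Finset.univ.filter (IsCrowdedFace K k)).card : ℝ)) _)]
  refine integral_mono (integrable_comp_softCechComplex r (fun K => (betti F K k : ℝ)) _)
    ((integrable_comp_softCechComplex r (fun K => (numEmptySimplexComponents k K : ℝ)) _).add
    (integrable_comp_softCechComplex r (fun K =>
      ((Finset.univ.filter (IsCrowdedFace K k)).card : ℝ)) _)) fun ω => ?_
  simp only [numEmptySimplexComponents_eq_card _ hk]
  exact_mod_cast betti_le_card_add_card F _ k hk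

omit [ProperSpace E] in
/-- A lower bound for the probability that `S` spans an isolated empty simplex, in terms of a set
`G` of configurations whose proper subsets have intersecting balls. -/
theorem le_sampleLaw_real_isEmptyComponent (hk : 1 ≤ k) (hr : 0 ≤ r)
    (hq : ∀ a, μ.real (Metric.closedBall a (3 * r)) ≤ q)
    {G : Set (Fin (k + 2) → E)} (hG : MeasurableSet G) {X : Set Bool}
    (hGball : ∀ x ∈ G, ∀ t ⊂ (Finset.univ : Finset (Fin (k + 2))),
      (⋂ i ∈ t, Metric.closedBall (x i) (r / 2)).Nonempty)
    (hGX : ∀ x ∈ G, ∀ c ∈ X, ¬ (⋂ i, Metric.closedBall (x i) (r / 2)).Nonempty ∨ c = false)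
    {S : Finset (Fin n)} (hS : S.card = k + 2) :
    ((Measure.pi fun _ : Fin (k + 2) => μ).real G - n * q ^ (k + 2)) *
      ((∏ i ∈ Finset.Icc 1 k, (p i : ℝ) ^ (k + 2).choose (i + 1)) *
        (ProbabilityTheory.bernoulliMeasure true false (p (k + 1))).real X) ≤
      (sampleLaw μ p n).real {ω | IsEmptyComponent (softCechComplex r ω.1 ω.2) k S} := by
  classical
  let e : Fin (k + 2) ↪ Fin n := (S.orderEmbOfFin hS).toEmbedding
  have he : Finset.univ.map e = S := by
    ext i
    have := Finset.range_orderEmbOfFin S hS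
    rw [← Finset.mem_coe (s := S), ← this]
    simp [e]
  have heS : ∀ j, e j ∈ S := fun j => he ▸ Finset.mem_map_of_mem e (Finset.mem_univ j)
  let o : Fin n := e 0
  let N : Fin n → Set (Fin n → E) := fun v => {x | ∀ i ∈ insert v S, dist (x i) (x o) ≤ 3 * r}
  let GS : Set (Fin n → E) := (fun x j => x (e j)) ⁻¹' G
  -- Coins of proper faces must succeed; the coin of `S` itself, of dimension `k + 1`, only has to
  -- lie in `X`.
  let A : ℕ → Set Bool := fun i => if i ≤ k then {true} else X
  let C : Set (Finset (Fin n) → Bool) := {b | ∀ τ ⊆ S, 2 ≤ τ.card → b τ ∈ A (τ.card - 1)}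
  -- The pattern on `S` has diameter at most `r`, so an outside point within `r` of it lies within
  -- `2r ≤ 3r` of `x o`. Removing the sets `N v` therefore forces isolation.
  have hsub : (GS \ ⋃ v ∈ Finset.univ \ S, N v) ×ˢ C ⊆
      {ω : (Fin n → E) × (Finset (Fin n) → Bool) |
        IsEmptyComponent (softCechComplex r ω.1 ω.2) k S} := by
    rintro ⟨x, b⟩ ⟨⟨hx, hxN⟩, hb⟩
    have hball : ∀ t ⊂ S, (⋂ i ∈ t, Metric.closedBall (x i) (r / 2)).Nonempty := by
      intro t ht
      obtain ⟨y, hy⟩ := hGball _ hx (Finset.univ.filter fun j => e j ∈ t) (by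
        rw [Finset.ssubset_univ_iff]
        intro h
        refine ht.2 ?_
        rw [← he]
        intro i hi
        obtain ⟨j, -, rfl⟩ := Finset.mem_map.1 hi
        have : j ∈ Finset.univ.filter fun j => e j ∈ t := by rw [h]; exact Finset.mem_univ j
        exact (Finset.mem_filter.1 this).2)
      refine ⟨y, Set.mem_iInter₂.2 fun i hi => ?_⟩
      have hiS : i ∈ S := ht.1 hi
      rw [← he] at hiS
      obtain ⟨j, -, rfl⟩ := Finset.mem_map.1 hiS
      exact Set.mem_iInter₂.1 hy j (Finset.mem_filter.2 ⟨Finset.mem_univ _, hi⟩)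
    have hdist : ∀ i ∈ S, ∀ j ∈ S, dist (x i) (x j) ≤ r := by
      intro i hi j hj
      refine dist_le_of_iInter_closedBall_nonempty (hball {i, j} ?_) (by simp) (by simp)
      refine Finset.ssubset_iff_subset_ne.2
        ⟨Finset.insert_subset hi (by simpa using hj), fun h => ?_⟩
      have h2 := Finset.card_le_two (a := i) (b := j)
      rw [h] at h2
      omega
    refine isEmptyComponent_softCechComplex hr hS hball (fun τ hτ h2 => ?_) ?_ ?_
    · have h3 := hb τ hτ.1 h2
      have h4 := Finset.card_lt_card hτ
      simp only [A] at h3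
      rwa [if_pos (by omega)] at h3
    · have h3 := hb S subset_rfl (by omega)
      simp only [A] at h3
      rw [if_neg (by omega)] at h3
      refine (hGX _ hx _ h3).imp_left fun h4 h5 => h4 ?_
      obtain ⟨y, hy⟩ := h5
      exact ⟨y, Set.mem_iInter.2 fun j => Set.mem_iInter₂.1 hy (e j) (heS j)⟩
    · intro i hi j hj
      by_contra! hle
      refine hxN (Set.mem_iUnion₂.2 ⟨j, by simpa using hj, fun l hl => ?_⟩)
      rcases Finset.mem_insert.1 hl with rfl | hl
      · linarith [dist_triangle (x l) (x i) (x o), hdist i hi o (heS 0)]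
      · linarith [hdist l hl o (heS 0)]
  have hC := pi_bernoulliMeasure_real_setOf_subsets p A S
  rw [hS, show k + 2 - 1 = k + 1 from rfl, Finset.prod_Icc_succ_top (by omega)] at hC
  have hA1 : ∀ i ∈ Finset.Icc 1 k, A i = {true} := fun i hi =>
    if_pos (Finset.mem_Icc.1 hi).2
  have hA2 : A (k + 1) = X := if_neg (by omega)
  rw [hA2, Nat.choose_self, pow_one, Finset.prod_congr rfl fun i hi => by
    rw [hA1 i hi, bernoulliMeasure_real_singleton_true]] at hC
  refine le_trans ?_ (measureReal_mono hsub)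
  rw [measureReal_prod_prod]
  refine mul_le_mul ?_ hC.ge ?_ measureReal_nonneg
  · have hGS : (Measure.pi fun _ : Fin n => μ).real GS =
        (Measure.pi fun _ : Fin (k + 2) => μ).real G :=
      congrArg ENNReal.toReal ((measurePreserving_pi_comp_embedding μ e).measure_preimage
        hG.nullMeasurableSet)
    have h1 : (Measure.pi fun _ : Fin n => μ).real (⋃ v ∈ Finset.univ \ S, N v) ≤
        n * q ^ (k + 2) := by
      refine (measureReal_biUnion_finset_le _ _).trans ?_
      refine (Finset.sum_le_card_nsmul _ _ (q ^ (k + 2)) fun v hv => ?_).trans ?_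
      · have hvS : v ∉ S := by simpa using hv
        have h := pi_real_setOf_forall_dist_le_le hq (T := insert v S) (o := o)
          (Finset.mem_insert_of_mem (heS 0))
        rwa [Finset.card_insert_of_notMem hvS, hS] at h
      · rw [nsmul_eq_mul]
        refine mul_le_mul_of_nonneg_right ?_ (pow_nonneg (nonneg_of_measureReal_closedBall_le hq) _)
        exact_mod_cast (Finset.card_le_univ _).trans (by simp)
    rw [← hGS]
    exact (sub_le_sub_left h1 _).trans (le_measureReal_sdiff (measure_ne_top _ _))
  · exact mul_nonneg (Finset.prod_nonneg fun i _ => pow_nonneg (p i).2.1 _) measureReal_nonneg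

theorem le_integral_numEmptySimplexComponents (hk : 1 ≤ k) (hr : 0 ≤ r)
    (hq : ∀ a, μ.real (Metric.closedBall a (3 * r)) ≤ q)
    {G : Set (Fin (k + 2) → E)} (hG : MeasurableSet G) {X : Set Bool}
    (hGball : ∀ x ∈ G, ∀ t ⊂ (Finset.univ : Finset (Fin (k + 2))),
      (⋂ i ∈ t, Metric.closedBall (x i) (r / 2)).Nonempty)
    (hGX : ∀ x ∈ G, ∀ c ∈ X, ¬ (⋂ i, Metric.closedBall (x i) (r / 2)).Nonempty ∨ c = false) :
    n.choose (k + 2) * (((Measure.pi fun _ : Fin (k + 2) => μ).real G - n * q ^ (k + 2)) *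
      ((∏ i ∈ Finset.Icc 1 k, (p i : ℝ) ^ (k + 2).choose (i + 1)) *
        (ProbabilityTheory.bernoulliMeasure true false (p (k + 1))).real X)) ≤
      ∫ ω, (numEmptySimplexComponents k (softCechComplex r ω.1 ω.2) : ℝ) ∂(sampleLaw μ p n) := by
  classical
  simp only [numEmptySimplexComponents_eq_card _ hk]
  rw [integral_card_filter_softCechComplex r _ fun K S => IsEmptyComponent K k S]
  refine le_trans ?_ (Finset.sum_le_univ_sum_of_nonneg
    (s := Finset.powersetCard (k + 2) Finset.univ) fun S => measureReal_nonneg)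
  have h := Finset.card_nsmul_le_sum (Finset.powersetCard (k + 2) (Finset.univ : Finset (Fin n)))
    (fun S => (sampleLaw μ p n).real {ω | IsEmptyComponent (softCechComplex r ω.1 ω.2) k S}) _
    fun S hS => le_sampleLaw_real_isEmptyComponent hk hr hq hG hGball hGX
      (Finset.mem_powersetCard.1 hS).2
  rwa [nsmul_eq_mul, Finset.card_powersetCard, Finset.card_univ, Fintype.card_fin] at h

end Expectations

/-! ### A robust pattern for an empty simplex -/

section Configuration

variable {E : Type*} [NormedAddCommGroup E] [InnerProductSpace ℝ E]

/-- There are unit vectors which lie in no open unit ball all together, while any proper subset of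
them does. -/
theorem exists_unit_vectors_of_orthonormal {k : ℕ} {e : Fin (k + 1) → E} (he : Orthonormal ℝ e) :
    ∃ Y : Fin (k + 2) → E, (∀ c, ∃ i, 1 ≤ ‖c - Y i‖) ∧
      ∀ j, ∃ c, ∀ i, i ≠ j → ‖c - Y i‖ < 1 := by
  have hee : ∀ i j, inner ℝ (e i) (e j) = if i = j then (1 : ℝ) else 0 :=
    orthonormal_iff_ite.1 he
  set s : ℝ := √(k + 1) with hs
  have hs0 : 0 < s := Real.sqrt_pos.2 (by positivity)
  have hs2 : s ^ 2 = k + 1 := Real.sq_sqrt (by positivity)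
  set w : E := ∑ l, e l with hw
  have hwe : ∀ i, inner ℝ w (e i) = (1 : ℝ) := by
    intro i
    rw [hw, sum_inner]
    simp [hee]
  have hew : ∀ i, inner ℝ (e i) w = (1 : ℝ) := fun i => by rw [real_inner_comm, hwe]
  have hww : inner ℝ w w = (k + 1 : ℝ) := by
    conv_lhs => rw [hw, sum_inner]
    simp [← hw, hew]
  -- A positive combination of these unit vectors is zero, so no `c` has a positive inner product
  -- with all of them; yet `‖c - Y i‖ < 1` would force this inner product to be positive.
  let Y : Fin (k + 2) → E := Fin.cons (-s⁻¹ • w) e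
  have hY0 : Y 0 = -s⁻¹ • w := rfl
  have hYs : ∀ i : Fin (k + 1), Y i.succ = e i := fun i => rfl
  have hYn : ∀ i, ‖Y i‖ ^ 2 = 1 := by
    intro i
    refine Fin.cases ?_ (fun i => ?_) i
    · rw [hY0, ← real_inner_self_eq_norm_sq, inner_smul_left, inner_smul_right, hww, ← hs2]
      simp
      field_simp
    · rw [hYs, he.1 i, one_pow]
  have hexp : ∀ c i, ‖c - Y i‖ ^ 2 = ‖c‖ ^ 2 - 2 * inner ℝ c (Y i) + 1 := by
    intro c i
    rw [norm_sub_sq_real, hYn]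
  refine ⟨Y, fun c => ?_, fun j => ?_⟩
  · by_contra! h
    have hpos : ∀ i, 0 < inner ℝ c (Y i) := by
      intro i
      have h1 := hexp c i
      nlinarith [h i, norm_nonneg (c - Y i), sq_nonneg ‖c‖]
    have h0 := hpos 0
    rw [hY0, inner_smul_right, hw, inner_sum] at h0
    have h1 : 0 ≤ ∑ i, inner ℝ c (e i) := Finset.sum_nonneg fun i _ => (hpos i.succ).le
    have h2 : 0 < s⁻¹ := by positivity
    nlinarith
  · obtain ⟨c, δ, hδ, hc⟩ : ∃ c : E, ∃ δ > 0, ∀ i, i ≠ j → δ ≤ inner ℝ c (Y i) := by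
      refine Fin.cases ⟨w, 1, one_pos, fun i hi => ?_⟩ (fun l => ?_) j
      · obtain ⟨i, rfl⟩ := Fin.exists_succ_eq.2 hi
        rw [hYs, hwe]
      -- The coefficient `k + 2` exceeds `⟪w, w⟫ = k + 1` by one, which makes the product with `Y 0`
      -- equal to `s⁻¹`. The products with the remaining `e i` stay `1`.
      · refine ⟨w - (k + 2 : ℝ) • e l, min 1 s⁻¹, by positivity, fun i => ?_⟩
        refine Fin.cases (fun _ => ?_) (fun i hi => ?_) i
        · rw [hY0, inner_smul_right, inner_sub_left, hww, inner_smul_left, hew]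
          refine (min_le_right _ _).trans (le_of_eq ?_)
          simp
          ring
        · have hil : l ≠ i := fun h => hi (by rw [h])
          rw [hYs, inner_sub_left, hwe, inner_smul_left, hee, if_neg hil]
          simp
    have hcn : 0 < ‖c‖ := by
      rw [norm_pos_iff]
      rintro rfl
      obtain ⟨i, hi⟩ := exists_ne j
      have := hc i hi
      rw [inner_zero_left] at this
      linarith
    -- For the multiple `t • c`, the squared distance is at most `1 - 2tδ + t²‖c‖²`; this choice of
    -- `t` minimises it, with value `1 - tδ`.
    refine ⟨(δ / ‖c‖ ^ 2) • c, fun i hi => ?_⟩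
    have h1 := hexp ((δ / ‖c‖ ^ 2) • c) i
    rw [norm_smul, Real.norm_of_nonneg (by positivity), inner_smul_left] at h1
    simp only [conj_trivial] at h1
    have h2 : δ / ‖c‖ ^ 2 * δ ≤ δ / ‖c‖ ^ 2 * inner ℝ c (Y i) :=
      mul_le_mul_of_nonneg_left (hc i hi) (by positivity)
    have h3 : (δ / ‖c‖ ^ 2 * ‖c‖) ^ 2 = δ / ‖c‖ ^ 2 * δ := by field_simp
    have h4 : 0 < δ / ‖c‖ ^ 2 * δ := by positivity
    nlinarith [norm_nonneg ((δ / ‖c‖ ^ 2) • c - Y i)]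

theorem exists_lt_forall_le {ι : Type*} [Finite ι] [Nonempty ι] {a : ι → ℝ} {b : ℝ}
    (h : ∀ i, a i < b) : ∃ R < b, ∀ i, a i ≤ R := by
  obtain ⟨i, hi⟩ := Finite.exists_max a
  exact ⟨a i, h i, hi⟩

/-- A stable configuration of points, any proper subset of which has intersecting balls while the
balls about all the points have no common point. -/
theorem exists_stable_empty_configuration {k : ℕ} {e : Fin (k + 1) → E}
    (he : Orthonormal ℝ e) :
    ∃ (v : Fin (k + 1) → E) (η : ℝ), 0 < η ∧ ∀ r : ℝ, 0 < r → ∀ x : Fin (k + 2) → E,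
      (∀ i : Fin (k + 1), dist (x i.succ - x 0) (r • v i) < η * r) →
      (∀ t ⊂ (Finset.univ : Finset (Fin (k + 2))),
        (⋂ i ∈ t, Metric.closedBall (x i) (r / 2)).Nonempty) ∧
      ¬ (⋂ i, Metric.closedBall (x i) (r / 2)).Nonempty := by
  obtain ⟨Y, hY1, hY2⟩ := exists_unit_vectors_of_orthonormal he
  choose c hc using hY2
  obtain ⟨R, hR, hRle⟩ : ∃ R < (1 : ℝ), ∀ q : Fin (k + 2) × Fin (k + 2),
      (if q.2 ≠ q.1 then ‖c q.1 - Y q.2‖ else 0) ≤ R := by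
    refine exists_lt_forall_le fun q => ?_
    split_ifs with h
    · exact hc _ _ h
    · exact one_pos
  have hR0 : 0 ≤ R := by simpa using hRle (0, 0)
  have hcR : ∀ j i, i ≠ j → ‖c j - Y i‖ ≤ R := fun j i h => by
    have := hRle (j, i)
    rwa [if_pos h] at this
  -- The pattern is rescaled by `s`, slightly above `1/2`. With `R = 1 - 8η`, errors up to `η` keep
  -- proper subsets within `s * R + η ≤ 1/2` of a centre, while `s - η > 1/2` keeps the whole set
  -- from having one.
  set η : ℝ := (1 - R) / 8 with hη
  have hη0 : 0 < η := by rw [hη]; linarith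
  set s : ℝ := 1 / 2 + 2 * η with hs
  have hsR : s * R + η ≤ 1 / 2 := by rw [hs, hη]; nlinarith
  have hs0 : 0 < s := by rw [hs]; linarith
  refine ⟨fun i => s • (Y i.succ - Y 0), η, hη0, fun r hr x hx => ?_⟩
  -- The origin of the pattern is chosen so that `x 0` fits exactly; only the differences `x i.succ
  -- - x 0` carry errors.
  set u : E := x 0 - (r * s) • Y 0 with hu
  have hxu : ∀ i, ‖x i - (u + (r * s) • Y i)‖ ≤ η * r := by
    intro i
    refine Fin.cases ?_ (fun i => ?_) i
    · rw [hu]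
      simp only [sub_add_cancel, sub_self, norm_zero]
      positivity
    · have h := (hx i).le
      rw [dist_eq_norm] at h
      have heq : x i.succ - (u + (r * s) • Y i.succ) =
          x i.succ - x 0 - r • (s • (Y i.succ - Y 0)) := by
        rw [hu, smul_smul, smul_sub]
        abel
      rwa [heq]
  constructor
  · intro t ht
    obtain ⟨j, -, hj⟩ := Finset.exists_of_ssubset ht
    refine ⟨u + (r * s) • c j, Set.mem_iInter₂.2 fun i hi => ?_⟩
    rw [Metric.mem_closedBall, dist_comm, dist_eq_norm]
    have h1 : x i - (u + (r * s) • c j) =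
        (x i - (u + (r * s) • Y i)) - (r * s) • (c j - Y i) := by
      rw [smul_sub]; abel
    have h2 : ‖(r * s) • (c j - Y i)‖ ≤ r * s * R := by
      rw [norm_smul, Real.norm_of_nonneg (by positivity)]
      exact mul_le_mul_of_nonneg_left (hcR j i fun h => hj (h ▸ hi)) (by positivity)
    rw [h1]
    refine (norm_sub_le _ _).trans ?_
    nlinarith [hxu i]
  · rintro ⟨z, hz⟩
    rw [Set.mem_iInter] at hz
    obtain ⟨i, hi⟩ := hY1 ((r * s)⁻¹ • (z - u))
    have hzi := hz i
    rw [Metric.mem_closedBall, dist_eq_norm] at hzi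
    have h1 : z - u - (r * s) • Y i = (r * s) • ((r * s)⁻¹ • (z - u) - Y i) := by
      rw [smul_sub, smul_smul, mul_inv_cancel₀ (by positivity), one_smul]
    have h2 : r * s ≤ ‖z - u - (r * s) • Y i‖ := by
      rw [h1, norm_smul, Real.norm_of_nonneg (by positivity)]
      exact le_mul_of_one_le_right (by positivity) hi
    have h3 : z - u - (r * s) • Y i = (z - x i) + (x i - (u + (r * s) • Y i)) := by abel
    have h4 := norm_add_le (z - x i) (x i - (u + (r * s) • Y i))
    rw [← h3] at h4
    have h5 := hxu i
    have h6 : r * s = r / 2 + 2 * (η * r) := by rw [hs]; ring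
    have h7 : 0 < η * r := by positivity
    linarith

end Configuration

/-! ### Probability of a small-scale pattern -/

section Density

variable {E : Type*} [NormedAddCommGroup E] [MeasurableSpace E] [BorelSpace E]

theorem measurableSet_configuration [SecondCountableTopology E] {m : ℕ} (b : Fin m → E) (ρ : ℝ) :
    MeasurableSet {x : Fin (m + 1) → E |
      ∀ i : Fin m, dist (x i.succ - x 0) (b i) < ρ} := by
  have : {x : Fin (m + 1) → E | ∀ i : Fin m, dist (x i.succ - x 0) (b i) < ρ} =
      ⋂ i : Fin m, {x | dist (x i.succ - x 0) (b i) < ρ} := by ext; simp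
  rw [this]
  exact MeasurableSet.iInter fun i => (isOpen_lt (by fun_prop) (by fun_prop)).measurableSet

variable [NormedSpace ℝ E] [FiniteDimensional ℝ E] {ν : Measure E} [ν.IsAddHaarMeasure]

/-- A set of finite measure loses little of its mass under small translations. -/
theorem exists_forall_norm_lt_measure_sdiff_preimage_add_le {A : Set E} (hA : MeasurableSet A)
    (hAfin : ν A ≠ ⊤) {ε : ENNReal} (hε : 0 < ε) :
    ∃ δ > 0, ∀ v : E, ‖v‖ < δ → ν (A \ (fun y => y + v) ⁻¹' A) ≤ ε := by
  let T : C(E, C(E, E)) := ContinuousMap.curry ⟨fun q : E × E => q.2 + q.1, by fun_prop⟩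
  have hT : ∀ v y, T v y = y + v := fun v y => rfl
  have hlim := tendsto_measure_symmDiff_preimage_nhds_zero (μ := ν) (ν := ν) (s := A)
    (T.continuous.tendsto 0)
    (Eventually.of_forall fun v => measurePreserving_add_right ν v)
    (measurePreserving_add_right ν 0) hA.nullMeasurableSet hAfin
  have hev := (ENNReal.tendsto_nhds_zero.1 hlim) ε hε
  obtain ⟨δ, hδ, h⟩ := Metric.eventually_nhds_iff.1 hev
  refine ⟨δ, hδ, fun v hv => (measure_mono ?_).trans (h (by simpa using hv))⟩
  intro y hy
  refine Or.inr ⟨?_, hy.2⟩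
  simpa [hT] using hy.1

theorem half_measure_le_measure_setOf_add_mem {A : Set E} (hA : MeasurableSet A)
    (hA0 : ν A ≠ 0) (hAfin : ν A ≠ ⊤) (m : ℕ) :
    ∃ δ > 0, ∀ v : Fin m → E, (∀ i, ‖v i‖ < δ) →
      ν A / 2 ≤ ν {y | y ∈ A ∧ ∀ i, y + v i ∈ A} := by
  -- Each of the `m` translates may lose a share of `ν A / 2`; the divisor `m + 1` also covers `m =
  -- 0`.
  obtain ⟨δ, hδ, h⟩ := exists_forall_norm_lt_measure_sdiff_preimage_add_le hA hAfin
    (ε := ν A / 2 / (m + 1)) (ENNReal.div_pos (ENNReal.div_pos hA0 (by simp)).ne'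
      (ENNReal.add_ne_top.2 ⟨ENNReal.natCast_ne_top m, ENNReal.one_ne_top⟩))
  refine ⟨δ, hδ, fun v hv => ?_⟩
  have hsub : A ⊆ {y | y ∈ A ∧ ∀ i, y + v i ∈ A} ∪ ⋃ i, A \ (fun y => y + v i) ⁻¹' A := by
    intro y hy
    by_cases hall : ∀ i, y + v i ∈ A
    · exact Or.inl ⟨hy, hall⟩
    · push Not at hall
      obtain ⟨i, hi⟩ := hall
      exact Or.inr (Set.mem_iUnion.2 ⟨i, hy, hi⟩)
  have hsum : ν (⋃ i, A \ (fun y => y + v i) ⁻¹' A) ≤ ν A / 2 := by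
    refine (measure_iUnion_fintype_le _ _).trans ?_
    refine (Finset.sum_le_card_nsmul _ _ _ fun i _ => h (v i) (hv i)).trans ?_
    rw [Finset.card_univ, Fintype.card_fin, nsmul_eq_mul]
    calc (m : ENNReal) * (ν A / 2 / (m + 1)) ≤ (m + 1) * (ν A / 2 / (m + 1)) := by
          gcongr; exact le_self_add
      _ = ν A / 2 := ENNReal.mul_div_cancel (by simp)
          (ENNReal.add_ne_top.2 ⟨ENNReal.natCast_ne_top m, ENNReal.one_ne_top⟩)
  have h2 : ν A ≤ ν {y | y ∈ A ∧ ∀ i, y + v i ∈ A} + ν A / 2 :=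
    (measure_mono hsub).trans ((measure_union_le _ _).trans (add_le_add_right hsum _))
  have h3 : ν A / 2 ≠ ⊤ := ENNReal.div_ne_top hAfin (by simp)
  rw [← ENNReal.add_halves (ν A)] at h2
  exact (ENNReal.add_le_add_iff_right h3).1 (by simpa [ENNReal.add_halves] using h2)

/-- Lower bound for the probability of a configuration at a small scale, for independent points
whose law has a density at least `a` on `A`. -/
theorem le_pi_setOf_dist_sub_lt {A : Set E} (hA : MeasurableSet A)
    (hA0 : ν A ≠ 0) (hAfin : ν A ≠ ⊤) {μ : Measure E} [IsProbabilityMeasure μ] {a : ENNReal}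
    (hμ : ∀ s, MeasurableSet s → a * ν (A ∩ s) ≤ μ s) {m : ℕ} (v : Fin m → E) {η : ℝ} (hη : 0 < η) :
    ∃ r₀ > 0, ∀ r : ℝ, 0 < r → r < r₀ →
      a ^ (m + 1) * (ν A / 2 * ν (Metric.ball 0 (η * r)) ^ m) ≤
        Measure.pi (fun _ : Fin (m + 1) => μ)
          {x | ∀ i : Fin m, dist (x i.succ - x 0) (r • v i) < η * r} := by
  obtain ⟨δ, hδ, hhalf⟩ := half_measure_le_measure_setOf_add_mem (ν := ν) hA hA0 hAfin m
  obtain ⟨V, hV0, hV⟩ : ∃ V > 0, ∀ i, ‖v i‖ ≤ V := by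
    obtain ⟨V, hV⟩ := (Set.finite_range fun i => ‖v i‖).bddAbove
    exact ⟨max V 1, by positivity, fun i => (hV ⟨i, rfl⟩).trans (le_max_left _ _)⟩
  refine ⟨δ / (V + η), by positivity, fun r hr hrr => ?_⟩
  have hrδ : r * (V + η) < δ := (lt_div_iff₀ (by positivity)).1 hrr
  let B : Fin m → Set E := fun i => Metric.ball (r • v i) (η * r)
  have hB : ∀ i, MeasurableSet (B i) := fun i => Metric.isOpen_ball.measurableSet
  have hBδ : ∀ i, ∀ y ∈ B i, ‖y‖ < δ := by
    intro i y hy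
    have h1 : ‖y - r • v i‖ < η * r := by simpa [B, dist_eq_norm] using hy
    have h2 : ‖r • v i‖ ≤ r * V := by
      rw [norm_smul, Real.norm_of_nonneg hr.le]
      exact mul_le_mul_of_nonneg_left (hV i) hr.le
    have h3 := norm_le_norm_sub_add y (r • v i)
    nlinarith
  -- Base point and displacements, with all points in `A`. Integrating first over the base point
  -- gives at least `ν A / 2` for every small displacement; integrating first over the displacements
  -- allows comparison with `μ`.
  let W : Set (E × (Fin m → E)) :=
    {q | q.1 ∈ A ∧ ∀ i, q.2 i ∈ B i ∧ q.1 + q.2 i ∈ A}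
  have hW : MeasurableSet W := by
    have : W = Prod.fst ⁻¹' A ∩ ⋂ i, ((fun q : E × (Fin m → E) => q.2 i) ⁻¹' B i ∩
        (fun q : E × (Fin m → E) => q.1 + q.2 i) ⁻¹' A) := by
      ext q; simp [W]
    rw [this]
    refine (measurable_fst hA).inter (MeasurableSet.iInter fun i => ?_)
    have hi : Measurable fun q : E × (Fin m → E) => q.2 i :=
      (measurable_pi_apply i).comp measurable_snd
    exact (hi (hB i)).inter ((measurable_fst.add hi) hA)
  have hWlow : ν A / 2 * ν (Metric.ball 0 (η * r)) ^ m ≤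
      (ν.prod (Measure.pi fun _ : Fin m => ν)) W := by
    rw [Measure.prod_apply_symm hW]
    calc ν A / 2 * ν (Metric.ball 0 (η * r)) ^ m
        = ∫⁻ _ in Set.pi Set.univ B, ν A / 2 ∂(Measure.pi fun _ : Fin m => ν) := by
          rw [setLIntegral_const, Measure.pi_pi]
          simp [B, Measure.addHaar_ball_center]
      _ ≤ ∫⁻ y in Set.pi Set.univ B, ν ((fun x => (x, y)) ⁻¹' W)
            ∂(Measure.pi fun _ : Fin m => ν) := by
          refine setLIntegral_mono' (MeasurableSet.univ_pi hB) fun y hy => ?_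
          refine (hhalf y fun i => hBδ i _ (hy i (Set.mem_univ i))).trans (measure_mono ?_)
          intro x hx
          exact ⟨hx.1, fun i => ⟨hy i (Set.mem_univ i), hx.2 i⟩⟩
      _ ≤ ∫⁻ y, ν ((fun x => (x, y)) ⁻¹' W) ∂(Measure.pi fun _ : Fin m => ν) :=
          setLIntegral_le_lintegral _ _
  have hrestr : a • ν.restrict A ≤ μ := by
    refine Measure.le_iff.2 fun s hs => ?_
    rw [Measure.smul_apply, Measure.restrict_apply hs, smul_eq_mul, Set.inter_comm]
    exact hμ s hs
  let G : Set (E × (Fin m → E)) := {q | ∀ i, dist (q.2 i - q.1) (r • v i) < η * r}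
  have hG : MeasurableSet G := by
    have : G = ⋂ i, {q : E × (Fin m → E) | dist (q.2 i - q.1) (r • v i) < η * r} := by
      ext; simp [G]
    rw [this]
    exact MeasurableSet.iInter fun i => (isOpen_lt (by fun_prop) (by fun_prop)).measurableSet
  have hsec : ∀ x ∈ A, a ^ m * Measure.pi (fun _ : Fin m => ν) (Prod.mk x ⁻¹' W) ≤
      Measure.pi (fun _ : Fin m => μ) (Prod.mk x ⁻¹' G) := by
    intro x hx
    have h1 : Prod.mk x ⁻¹' W = Set.pi Set.univ fun i => (fun y => x + y) ⁻¹'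
        (A ∩ Metric.ball (x + r • v i) (η * r)) := by
      ext y
      simp [W, B, Set.mem_pi, hx, and_comm]
    have h2 : Prod.mk x ⁻¹' G =
        Set.pi Set.univ fun i => Metric.ball (x + r • v i) (η * r) := by
      ext y
      simp only [G, Set.mem_preimage, Set.mem_ofPred_eq, Set.mem_pi, Set.mem_univ, true_implies,
        Metric.mem_ball, dist_eq_norm, sub_add_eq_sub_sub]
    rw [h1, h2, Measure.pi_pi, Measure.pi_pi]
    simp only [measure_preimage_add]
    calc a ^ m * ∏ i, ν (A ∩ Metric.ball (x + r • v i) (η * r))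
        = ∏ i, a * ν (A ∩ Metric.ball (x + r • v i) (η * r)) := by
          simp [Finset.prod_mul_distrib]
      _ ≤ _ := Finset.prod_le_prod' fun i _ => hμ _ Metric.isOpen_ball.measurableSet
  have hmp := measurePreserving_piFinSuccAbove (fun _ : Fin (m + 1) => μ) 0
  calc a ^ (m + 1) * (ν A / 2 * ν (Metric.ball 0 (η * r)) ^ m)
      ≤ a ^ (m + 1) * (ν.prod (Measure.pi fun _ : Fin m => ν)) W := by gcongr
    _ = a ^ (m + 1) * ∫⁻ x in A, Measure.pi (fun _ : Fin m => ν) (Prod.mk x ⁻¹' W) ∂ν := by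
        rw [Measure.prod_apply hW, setLIntegral_eq_of_support_subset]
        intro x hx
        by_contra hxA
        refine hx ?_
        have : Prod.mk x ⁻¹' W = ∅ := Set.eq_empty_of_forall_notMem fun y hy => hxA hy.1
        simp [this]
    _ = a * ∫⁻ x in A, a ^ m * Measure.pi (fun _ : Fin m => ν) (Prod.mk x ⁻¹' W) ∂ν := by
        rw [lintegral_const_mul _ (measurable_measure_prodMk_left hW), pow_succ']
        ring
    _ ≤ a * ∫⁻ x in A, Measure.pi (fun _ : Fin m => μ) (Prod.mk x ⁻¹' G) ∂ν := by
        exact mul_le_mul_right (setLIntegral_mono' hA hsec) _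
    _ = ∫⁻ x, Measure.pi (fun _ : Fin m => μ) (Prod.mk x ⁻¹' G) ∂(a • ν.restrict A) := by
        rw [lintegral_smul_measure, smul_eq_mul]
    _ ≤ ∫⁻ x, Measure.pi (fun _ : Fin m => μ) (Prod.mk x ⁻¹' G) ∂μ :=
        lintegral_mono' hrestr le_rfl
    _ = (μ.prod (Measure.pi fun _ : Fin m => μ)) G := (Measure.prod_apply hG).symm
    _ = Measure.pi (fun _ : Fin (m + 1) => μ)
          (MeasurableEquiv.piFinSuccAbove (fun _ => E) 0 ⁻¹' G) :=
        (hmp.measure_preimage hG.nullMeasurableSet).symm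
    _ = _ := by
        congr 1

end Density

/-! ### Bounds from the density -/

section PointLaw

variable {d : ℕ} {f : EuclideanSpace ℝ (Fin d) → ℝ}

theorem isProbabilityMeasure_withDensity_of_integral_eq_one {α : Type*} [MeasurableSpace α]
    {ν : Measure α} {g : α → ℝ} (hg : ∀ x, 0 ≤ g x) (hint : ∫ x, g x ∂ν = 1) :
    IsProbabilityMeasure (ν.withDensity fun y => ENNReal.ofReal (g y)) := by
  refine ⟨?_⟩
  have hi : Integrable g ν := by
    by_contra h
    rw [integral_undef h] at hint
    exact zero_ne_one hint
  rw [withDensity_apply _ MeasurableSet.univ, Measure.restrict_univ,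
    ← ofReal_integral_eq_lintegral_ofReal hi (Eventually.of_forall hg), hint, ENNReal.ofReal_one]

theorem exists_withDensity_real_closedBall_le (hf_bdd : ∃ M : ℝ, ∀ᵐ x, f x ≤ M) :
    ∃ C : ℝ, 0 ≤ C ∧ ∀ ρ : ℝ, 0 ≤ ρ → ∀ a,
      (volume.withDensity fun y => ENNReal.ofReal (f y)).real (Metric.closedBall a ρ) ≤
        C * ρ ^ d := by
  obtain ⟨M, hM⟩ := hf_bdd
  let ω := volume.real (Metric.ball (0 : EuclideanSpace ℝ (Fin d)) 1)
  refine ⟨max M 0 * ω, by positivity, fun ρ hρ a => ?_⟩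
  have h1 : (volume.withDensity fun y => ENNReal.ofReal (f y)) (Metric.closedBall a ρ) ≤
      ENNReal.ofReal (max M 0) * volume (Metric.closedBall a ρ) := by
    rw [withDensity_apply _ Metric.isClosed_closedBall.measurableSet, ← setLIntegral_const]
    refine lintegral_mono_ae (ae_restrict_of_ae ?_)
    filter_upwards [hM] with x hx
    exact ENNReal.ofReal_le_ofReal (hx.trans (le_max_left _ _))
  have h2 := ENNReal.toReal_mono
    (ENNReal.mul_ne_top ENNReal.ofReal_ne_top measure_closedBall_lt_top.ne) h1
  rw [Measure.addHaar_closedBall volume a hρ, ENNReal.toReal_mul, ENNReal.toReal_mul,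
    ENNReal.toReal_ofReal (le_max_right _ _), ENNReal.toReal_ofReal (by positivity),
    finrank_euclideanSpace_fin] at h2
  refine h2.trans (le_of_eq ?_)
  simp only [ω, Measure.real]
  ring

/-- Some level set `{f ≥ 1/(m+1)}` has positive measure, as otherwise `f ≤ 0` almost everywhere;
integrability makes its measure finite. -/
theorem exists_measurableSet_le_withDensity (hf_meas : Measurable f) (hf_int : ∫ x, f x = 1) :
    ∃ (A : Set (EuclideanSpace ℝ (Fin d))) (a : ℝ), 0 < a ∧ MeasurableSet A ∧ volume A ≠ 0 ∧
      volume A ≠ ⊤ ∧ ∀ s, MeasurableSet s → ENNReal.ofReal a * volume (A ∩ s) ≤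
        (volume.withDensity fun y => ENNReal.ofReal (f y)) s := by
  have hi : Integrable f := by
    by_contra h
    rw [integral_undef h] at hf_int
    exact zero_ne_one hf_int
  obtain ⟨m, hm⟩ : ∃ m : ℕ, volume {x | 1 / ((m : ℝ) + 1) ≤ f x} ≠ 0 := by
    by_contra! h
    have hae : ∀ᵐ x, f x ≤ 0 := by
      have h1 : ∀ᵐ x, ∀ m : ℕ, ¬ 1 / ((m : ℝ) + 1) ≤ f x :=
        ae_all_iff.2 fun m => by simpa [ae_iff] using h m
      filter_upwards [h1] with x hx
      by_contra! hpos
      obtain ⟨m, hm⟩ := exists_nat_one_div_lt hpos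
      exact hx m hm.le
    have := integral_nonpos_of_ae hae
    linarith
  have ha : (0 : ℝ) < 1 / ((m : ℝ) + 1) := by positivity
  have hA : MeasurableSet {x | 1 / ((m : ℝ) + 1) ≤ f x} := measurableSet_le measurable_const hf_meas
  refine ⟨_, 1 / ((m : ℝ) + 1), ha, hA, hm, (hi.measure_ge_lt_top ha).ne, fun s hs => ?_⟩
  rw [withDensity_apply _ hs, ← setLIntegral_const]
  refine (setLIntegral_mono' (hA.inter hs) fun x hx => ENNReal.ofReal_le_ofReal hx.1).trans ?_
  exact lintegral_mono_set Set.inter_subset_right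

theorem exists_le_pi_real_setOf_dist_sub_lt (hf_meas : Measurable f) (hf_nonneg : ∀ x, 0 ≤ f x)
    (hf_int : ∫ x, f x = 1) {m : ℕ} (v : Fin m → EuclideanSpace ℝ (Fin d)) {η : ℝ} (hη : 0 < η) :
    ∃ c > 0, ∃ r₀ > 0, ∀ r : ℝ, 0 < r → r < r₀ →
      c * (r ^ d) ^ m ≤ (Measure.pi fun _ : Fin (m + 1) =>
        volume.withDensity fun y => ENNReal.ofReal (f y)).real
          {x | ∀ i : Fin m, dist (x i.succ - x 0) (r • v i) < η * r} := by
  have hprob := isProbabilityMeasure_withDensity_of_integral_eq_one hf_nonneg hf_int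
  obtain ⟨A, a, ha, hA, hA0, hAfin, hμ⟩ := exists_measurableSet_le_withDensity hf_meas hf_int
  obtain ⟨r₀, hr₀, h⟩ := le_pi_setOf_dist_sub_lt hA hA0 hAfin hμ v hη
  let ω := volume.real (Metric.ball (0 : EuclideanSpace ℝ (Fin d)) 1)
  have hω : 0 < ω :=
    ENNReal.toReal_pos (Metric.measure_ball_pos _ _ one_pos).ne' measure_ball_lt_top.ne
  have hA' : 0 < volume.real A := ENNReal.toReal_pos hA0 hAfin
  refine ⟨a ^ (m + 1) * (volume.real A / 2 * (η ^ d * ω) ^ m), by positivity, r₀, hr₀,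
    fun r hr hrr => ?_⟩
  have h1 := ENNReal.toReal_mono (measure_ne_top _ _) (h r hr hrr)
  rw [Measure.addHaar_ball_of_pos volume _ (by positivity), ENNReal.toReal_mul, ENNReal.toReal_mul,
    ENNReal.toReal_pow, ENNReal.toReal_pow, ENNReal.toReal_mul, ENNReal.toReal_div,
    ENNReal.toReal_ofReal ha.le, ENNReal.toReal_ofReal (by positivity),
    finrank_euclideanSpace_fin] at h1
  refine le_trans (le_of_eq ?_) h1
  simp only [ω, Measure.real, ENNReal.toReal_ofNat, mul_pow]
  ring

end PointLaw

/-! ### Comparison of the two expectations -/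

section Asymptotics

theorem pow_div_le_choose {m n : ℕ} (h : 2 * m ≤ n) :
    (n : ℝ) ^ m / (2 ^ m * m.factorial) ≤ n.choose m := by
  have h1 := Nat.pow_le_choose (α := ℝ) m n
  rw [div_le_iff₀' (by positivity)] at h1 ⊢
  have h2 : (n : ℝ) / 2 ≤ ((n + 1 - m : ℕ) : ℝ) := by
    rw [Nat.cast_sub (by omega)]
    have : (2 : ℝ) * m ≤ n := by exact_mod_cast h
    push_cast
    linarith
  have h3 : ((n : ℝ) / 2) ^ m ≤ ((n + 1 - m : ℕ) : ℝ) ^ m := by gcongr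
  rw [div_pow, div_le_iff₀' (by positivity)] at h3
  calc (n : ℝ) ^ m ≤ 2 ^ m * (((n + 1 - m : ℕ) : ℝ) ^ m) := h3
    _ ≤ 2 ^ m * (m.factorial * n.choose m) := by gcongr
    _ = _ := by ring

/-- Pascal's rule splits the coins of the empty simplex into those of one facet and those of the
faces through the opposite vertex. The latter product is the denominator in the hypothesis. -/
theorem prod_pow_choose_succ (p : ℕ → ℝ) (k : ℕ) :
    ∏ i ∈ Finset.Icc 1 k, p i ^ (k + 2).choose (i + 1) =
      (∏ i ∈ Finset.Icc 1 k, p i ^ (k + 1).choose i) *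
        ∏ i ∈ Finset.Icc 1 k, p i ^ (k + 1).choose (i + 1) := by
  rw [← Finset.prod_mul_distrib]
  exact Finset.prod_congr rfl fun i _ => by rw [← pow_add, Nat.choose_succ_succ]

/-- The asymptotic equivalence, from a stable family of empty simplices which survive with
probability comparable to the law of the top coin on a set `X`. -/
theorem tendsto_expectedBetti_div_of_configuration (F : Type*) [Field F] {d k : ℕ} (hk : 1 ≤ k)
    {f : EuclideanSpace ℝ (Fin d) → ℝ} (hf_meas : Measurable f) (hf_nonneg : ∀ x, 0 ≤ f x)
    (hf_bdd : ∃ M : ℝ, ∀ᵐ x, f x ≤ M) (hf_int : ∫ x, f x = 1)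
    {r : ℕ → ℝ} (hr : ∀ᶠ n in atTop, 0 < r n) {p : ℕ → ℕ → unitInterval}
    (hp : ∀ᶠ n in atTop, ∀ i ∈ Finset.Icc 1 k, 0 < (p n i : ℝ))
    (hlim : Tendsto
      (fun n : ℕ => (n : ℝ) * r n ^ d / ∏ i ∈ Finset.Icc 1 k, (p n i : ℝ) ^ (k + 1).choose i)
      atTop (𝓝 0))
    {X : Set Bool} {s : ℕ → ℝ}
    (hsX : ∀ n, (ProbabilityTheory.bernoulliMeasure true false (p n (k + 1))).real X = s n)
    (hs : ∀ᶠ n in atTop, 0 < s n)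
    (hlims : Tendsto
      (fun n : ℕ => (n : ℝ) * r n ^ d /
        (s n * ∏ i ∈ Finset.Icc 1 k, (p n i : ℝ) ^ (k + 1).choose i)) atTop (𝓝 0))
    {v : Fin (k + 1) → EuclideanSpace ℝ (Fin d)} {η : ℝ} (hη : 0 < η)
    (hconf : ∀ ρ : ℝ, 0 < ρ → ∀ x : Fin (k + 2) → EuclideanSpace ℝ (Fin d),
      (∀ i : Fin (k + 1), dist (x i.succ - x 0) (ρ • v i) < η * ρ) →
      (∀ t ⊂ (Finset.univ : Finset (Fin (k + 2))),
        (⋂ i ∈ t, Metric.closedBall (x i) (ρ / 2)).Nonempty) ∧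
      ∀ c ∈ X, ¬ (⋂ i, Metric.closedBall (x i) (ρ / 2)).Nonempty ∨ c = false) :
    Tendsto (fun n : ℕ => expectedBetti F k n f (r n) (p n) /
      expectedEmptySimplexComponents k n f (r n) (p n)) atTop (𝓝 1) := by
  have hprob := isProbabilityMeasure_withDensity_of_integral_eq_one hf_nonneg hf_int
  obtain ⟨C, hC0, hC⟩ := exists_withDensity_real_closedBall_le hf_bdd
  obtain ⟨c, hc, r₀, hr₀, hG⟩ :=
    exists_le_pi_real_setOf_dist_sub_lt hf_meas hf_nonneg hf_int v hη
  set C₁ : ℝ := (C * 3 ^ d) ^ (k + 2) with hC₁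
  have hC₁0 : 0 ≤ C₁ := by positivity
  set c₂ : ℝ := c / 2 / (2 ^ (k + 2) * (k + 2).factorial) with hc₂
  have hc₂0 : 0 < c₂ := by positivity
  have hnr : Tendsto (fun n : ℕ => (n : ℝ) * r n ^ d) atTop (𝓝 0) := by
    refine squeeze_zero' ?_ ?_ hlim
    · filter_upwards [hr] with n hn
      positivity
    · filter_upwards [hr, hp] with n hn hpn
      refine le_div_self (by positivity) (Finset.prod_pos fun i hi => pow_pos (hpn i hi) _) ?_
      exact Finset.prod_le_one (fun i hi => pow_nonneg (p n i).2.1 _)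
        fun i hi => pow_le_one₀ (p n i).2.1 (p n i).2.2
  have key : ∀ᶠ n : ℕ in atTop,
      0 < expectedEmptySimplexComponents k n f (r n) (p n) ∧
      expectedEmptySimplexComponents k n f (r n) (p n) ≤ expectedBetti F k n f (r n) (p n) ∧
      expectedBetti F k n f (r n) (p n) ≤ expectedEmptySimplexComponents k n f (r n) (p n) +
        C₁ / c₂ * ((n : ℝ) * r n ^ d /
        (s n * ∏ i ∈ Finset.Icc 1 k, (p n i : ℝ) ^ (k + 1).choose i)) *
          expectedEmptySimplexComponents k n f (r n) (p n) := by
    -- The thresholds serve the bound on `n.choose (k + 2)`, an intrusion probability of at most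
    -- half the pattern probability, and `r n < r₀`. The `+ 1` guards against `C₁ = 0`.
    filter_upwards [hr, hp, hs, eventually_ge_atTop (2 * (k + 2)),
      hnr.eventually_lt_const (show 0 < c / 2 / (C₁ + 1) by positivity),
      hnr.eventually_lt_const (show 0 < r₀ ^ d by positivity)] with n hrn hpn hsn hn hsmall hrr
    have hn1 : (1 : ℝ) ≤ n := by exact_mod_cast (show 1 ≤ n by omega)
    have hrr₀ : r n < r₀ := lt_of_pow_lt_pow_left₀ d hr₀.le
      ((le_mul_of_one_le_left (by positivity) hn1).trans_lt hrr)
    set Q : ℝ := ∏ i ∈ Finset.Icc 1 k, (p n i : ℝ) ^ (k + 1).choose i with hQ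
    set R : ℝ := ∏ i ∈ Finset.Icc 1 k, (p n i : ℝ) ^ (k + 1).choose (i + 1) with hR
    have hQ0 : 0 < Q := Finset.prod_pos fun i hi => pow_pos (hpn i hi) _
    have hR0 : 0 < R := Finset.prod_pos fun i hi => pow_pos (hpn i hi) _
    have hq : ∀ a, (volume.withDensity fun y => ENNReal.ofReal (f y)).real
        (Metric.closedBall a (3 * r n)) ≤ C * (3 * r n) ^ d := hC _ (by positivity)
    have hqpow : (C * (3 * r n) ^ d) ^ (k + 2) = C₁ * (r n ^ d) ^ (k + 2) := by
      rw [hC₁, mul_pow 3, ← mul_assoc, mul_pow]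
    have hlow := le_integral_numEmptySimplexComponents (n := n) (p := p n) hk hrn.le hq
      (measurableSet_configuration (fun i => r n • v i) (η * r n)) (X := X)
      (fun x hx => (hconf (r n) hrn x hx).1) (fun x hx => (hconf (r n) hrn x hx).2)
    have hmono := integral_numEmptySimplexComponents_le_integral_betti (n := n) (p := p n)
      (r := r n) (μ := volume.withDensity fun y => ENNReal.ofReal (f y)) F hk
    have hup := integral_betti_le (n := n) (p := p n) F hk hrn.le hq
    change _ ≤ expectedEmptySimplexComponents k n f (r n) (p n) at hlow
    change expectedEmptySimplexComponents k n f (r n) (p n) ≤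
      expectedBetti F k n f (r n) (p n) at hmono
    change expectedBetti F k n f (r n) (p n) ≤
      expectedEmptySimplexComponents k n f (r n) (p n) + _ at hup
    set S := expectedEmptySimplexComponents k n f (r n) (p n)
    rw [hsX, prod_pow_choose_succ, hqpow] at hlow
    rw [hqpow] at hup
    set ρ : ℝ := r n ^ d with hρ
    have hρ0 : 0 < ρ := by positivity
    have hL : c₂ * (n ^ (k + 2) * ρ ^ (k + 1) * (Q * R * s n)) ≤ S := by
      refine le_trans ?_ hlow
      have h1 : c / 2 * ρ ^ (k + 1) ≤ (Measure.pi fun _ : Fin (k + 2) =>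
          volume.withDensity fun y => ENNReal.ofReal (f y)).real
          {x | ∀ i : Fin (k + 1), dist (x i.succ - x 0) (r n • v i) < η * r n} -
            n * (C₁ * ρ ^ (k + 2)) := by
        have h2 := hG (r n) hrn hrr₀
        have h3 : C₁ * (n * ρ) ≤ c / 2 := by
          rw [lt_div_iff₀ (by positivity)] at hsmall
          have : 0 ≤ (n : ℝ) * ρ := by positivity
          nlinarith
        have h4 : n * (C₁ * ρ ^ (k + 2)) = C₁ * (n * ρ) * ρ ^ (k + 1) := by ring
        have h5 : C₁ * (n * ρ) * ρ ^ (k + 1) ≤ c / 2 * ρ ^ (k + 1) := by gcongr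
        rw [h4]
        linarith
      calc c₂ * (n ^ (k + 2) * ρ ^ (k + 1) * (Q * R * s n))
          = (n : ℝ) ^ (k + 2) / (2 ^ (k + 2) * (k + 2).factorial) *
              (c / 2 * ρ ^ (k + 1) * (Q * R * s n)) := by rw [hc₂]; ring
        _ ≤ _ := by
            refine mul_le_mul (pow_div_le_choose hn) ?_ (by positivity) (by positivity)
            exact mul_le_mul_of_nonneg_right h1 (by positivity)
    have hSpos : 0 < S := lt_of_lt_of_le (by positivity) hL
    refine ⟨hSpos, hmono, hup.trans (add_le_add_right ?_ _)⟩
    -- The crowded term is the vanishing ratio times the lower bound for `S`; the factor `R` occurs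
    -- in both and cancels.
    calc (n : ℝ) ^ (k + 3) * (C₁ * ρ ^ (k + 2) * R)
        = C₁ / c₂ * (n * ρ / (s n * Q)) *
            (c₂ * (n ^ (k + 2) * ρ ^ (k + 1) * (Q * R * s n))) := by
          field_simp
          ring
      _ ≤ _ := mul_le_mul_of_nonneg_left hL (by positivity)
  have hup : Tendsto (fun n : ℕ => 1 + C₁ / c₂ * ((n : ℝ) * r n ^ d /
      (s n * ∏ i ∈ Finset.Icc 1 k, (p n i : ℝ) ^ (k + 1).choose i))) atTop (𝓝 1) := by
    simpa using (hlims.const_mul (C₁ / c₂)).const_add 1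
  refine tendsto_of_tendsto_of_tendsto_of_le_of_le' tendsto_const_nhds hup ?_ ?_
  · filter_upwards [key] with n hn
    exact (one_le_div hn.1).2 hn.2.1
  · filter_upwards [key] with n hn
    rw [div_le_iff₀ hn.1]
    linarith [hn.2.2]

end Asymptotics

end SoftCech

/-! ### The two regimes -/

theorem mainTheorem4 (F : Type*) [Field F] (d k : ℕ) (hk : 1 ≤ k)
    (f : EuclideanSpace ℝ (Fin d) → ℝ) (hf_meas : Measurable f) (hf_nonneg : ∀ x, 0 ≤ f x)
    (hf_bdd : ∃ M : ℝ, ∀ᵐ x, f x ≤ M) (hf_int : ∫ x, f x = 1)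
    (r : ℕ → ℝ) (hr : ∀ᶠ n in atTop, 0 < r n)
    (p : ℕ → ℕ → unitInterval)
    (hp : ∀ᶠ n in atTop, ∀ i ∈ Finset.Icc 1 k, 0 < (p n i : ℝ))
    (hlim : Tendsto
      (fun n : ℕ => (n : ℝ) * r n ^ d / ∏ i ∈ Finset.Icc 1 k, (p n i : ℝ) ^ (k + 1).choose i)
      atTop (𝓝 0))
    (hdim : k < d ∨
      ((∀ᶠ n in atTop, (p n (k + 1) : ℝ) < 1) ∧
        Tendsto
          (fun n : ℕ => (n : ℝ) * r n ^ d /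
            ((1 - (p n (k + 1) : ℝ)) * ∏ i ∈ Finset.Icc 1 k, (p n i : ℝ) ^ (k + 1).choose i))
          atTop (𝓝 0))) :
    Tendsto
      (fun n : ℕ => SoftCech.expectedBetti F k n f (r n) (p n) /
        SoftCech.expectedEmptySimplexComponents k n f (r n) (p n))
      atTop (𝓝 1) := by
  rcases hdim with hkd | ⟨hp1, hlim1⟩
  · have he : Orthonormal ℝ fun i : Fin (k + 1) =>
        EuclideanSpace.basisFun (Fin d) ℝ (Fin.castLE hkd i) :=
      (EuclideanSpace.basisFun (Fin d) ℝ).orthonormal.comp _ (Fin.castLE_injective hkd)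
    obtain ⟨v, η, hη, hconf⟩ := SoftCech.exists_stable_empty_configuration he
    -- The balls have no common point, so the top coin is irrelevant: `X` is everything and `s = 1`.
    refine SoftCech.tendsto_expectedBetti_div_of_configuration F hk hf_meas hf_nonneg hf_bdd
      hf_int hr hp hlim (X := Set.univ) (s := fun _ => 1) (fun n => by simp)
      (Eventually.of_forall fun _ => one_pos) (by simpa using hlim) hη (v := v) ?_
    exact fun ρ hρ x hx => ⟨(hconf ρ hρ x hx).1, fun c _ => Or.inl (hconf ρ hρ x hx).2⟩
  -- All points lie within half the scale of `x 0`, which is then common to all balls; the simplex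
  -- is empty because its own coin fails.
  · refine SoftCech.tendsto_expectedBetti_div_of_configuration F hk hf_meas hf_nonneg hf_bdd
      hf_int hr hp hlim (X := {false})
      (fun n => SoftCech.bernoulliMeasure_real_singleton_false (p n (k + 1)))
      (hp1.mono fun n hn => sub_pos.2 hn) hlim1 (v := 0) (η := 1 / 2) (by norm_num) ?_
    intro ρ hρ x hx
    refine ⟨fun t _ => ⟨x 0, Set.mem_iInter₂.2 fun i _ => ?_⟩, fun c hc => Or.inr hc⟩
    rw [Metric.mem_closedBall, dist_comm]
    refine Fin.cases (by rw [dist_self]; positivity) (fun i => ?_) i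
    have h := hx i
    simp only [Pi.zero_apply, smul_zero, dist_zero_right] at h
    rw [dist_eq_norm]
    linarith
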